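/- All matroids are finite. Write $r_M$ for the rank function of $M$, $r(M)$ for its rank and $M^*$ for its dual. A \emph{cyclic flat} of $M$ is a flat that is a (possibly empty) union of circuits; $\mathcal{Z}'(M)$ is the set of cyclic flats of $M$ other than $\emptyset$ and the ground set, and $FI(M)$ is the set of elements of $M$ that lie in no proper cyclic flat of $M$ (that is, no cyclic flat other than the ground set). The \emph{free extension} of $M$ by $x\notin E(M)$ is the matroid $M+x$ on $E(M)\cup\{x\}$ whose circuits are those of $M$ together with the sets $B\cup\{x\}$, $B$ a basis of $M$; the \emph{free coextension} is $M\times x=(M^*+x)^*$. A matroid $M$ is an \emph{intertwine} of $M_1$ and $M_2$ if $M$, but none of its proper minors, has both a minor isomorphic to $M_1$ and a minor isomorphic to $M_2$. **Theorem.** Let $M_1$ and $M_2$ be matroids on disjoint ground sets $S_1$ and $S_2$, such that no matroid isomorphic to $M_1$ (resp. $M_2$) can be obtained from $M_2$ (resp. $M_1$) by any combination of minors, free extensions and free coextensions. For $i\in\{1,2\}$ fix a set $S'_i$ with $FI(M_i)\subseteq S'_i\subseteq S_i-FI(M_i^*)$. Let $k\ge 4\max\{|S_1|,|S_2|\}$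 be an integer, and let $T_1$, $T_2$ be sets, disjoint from each other and from $S_1\cup S_2$, with $|T_1|=k-r(M_1)-|S'_2|$ and $|T_2|=k-r(M_2)-|S'_1|$. Then there is a unique matroid $M=M_k(M_1,S'_1,T_1;M_2,S'_2,T_2)$ on $S_1\cup S_2\cup T_1\cup T_2$ whose cyclic flats and their ranks are the following: $\emptyset$, of rank $0$; $S_1\cup S_2\cup T_1\cup T_2$, of rank $k$; $F\cup T_1\cup S'_2$, of rank $r_{M_1}(F)+|T_1|+|S'_2|$, for $F\in\mathcal{Z}'(M_1)$; and $F\cup T_2\cup S'_1$, of rank $r_{M_2}(F)+|T_2|+|S'_1|$, for $F\in\mathcal{Z}'(M_2)$. This rank-$k$ matroid $M$ is an intertwine of $M_1$ and $M_2$. Consequently, $M_1$ and $M_2$ have infinitely many pairwise nonisomorphic intertwines. -/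

import Mathlib

universe u v

namespace Matroid

/-- `F` is a cyclic flat of `M`: a flat that is a (possibly empty) union of circuits. -/
def IsCyclicFlat {α : Type u} (M : Matroid α) (F : Set α) : Prop :=
  M.IsFlat F ∧ ∃ 𝒞 : Set (Set α), (∀ C ∈ 𝒞, M.IsCircuit C) ∧ F = ⋃₀ 𝒞

/-- `F` belongs to the family `𝒵'(M)` of nonempty proper cyclic flats of `M`. -/
def IsNonemptyProperCyclicFlat {α : Type u} (M : Matroid α) (F : Set α) : Prop :=
  M.IsCyclicFlat F ∧ F.Nonempty ∧ F ≠ M.E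

/-- `FI(M)`: the elements of `M` that are in no proper cyclic flat of `M`. -/
def FI {α : Type u} (M : Matroid α) : Set α :=
  {x | x ∈ M.E ∧ ∀ F, M.IsCyclicFlat F → F ≠ M.E → x ∉ F}

/-- `M` and `N` are isomorphic: some bijection of the ground sets preserves independence in
both directions. -/
def IsIsomorphic {α : Type u} {β : Type v} (M : Matroid α) (N : Matroid β) : Prop :=
  ∃ e : M.E ≃ N.E, ∀ I : Set M.E,
    M.Indep (Subtype.val '' I) ↔ N.Indep (Subtype.val '' (e '' I))

/-- `M` has an `N`-minor, that is, a minor isomorphic to `N`. -/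
def HasMinorIso {α : Type u} {β : Type v} (M : Matroid α) (N : Matroid β) : Prop :=
  ∃ N' : Matroid α, N' ≤m M ∧ N'.IsIsomorphic N

/-- `M` is an intertwine of `M₁` and `M₂`: `M`, but none of its proper minors, has both an
`M₁`-minor and an `M₂`-minor. -/
def IsIntertwine {α : Type u} {β : Type v} (M : Matroid β) (M₁ M₂ : Matroid α) : Prop :=
  (M.HasMinorIso M₁ ∧ M.HasMinorIso M₂) ∧
    ∀ N : Matroid β, N <m M → ¬ (N.HasMinorIso M₁ ∧ N.HasMinorIso M₂)

/-- `N` is the free extension `M + x` of `M` by the element `x ∉ M.E`: its circuits are those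
of `M` together with the sets `B ∪ {x}` for `B` a base of `M`. -/
structure IsFreeExtension {α : Type u} (M : Matroid α) (x : α) (N : Matroid α) : Prop where
  notMem : x ∉ M.E
  ground_eq : N.E = insert x M.E
  isCircuit_iff : ∀ C, N.IsCircuit C ↔ M.IsCircuit C ∨ ∃ B, M.IsBase B ∧ C = insert x B

/-- `N` is the free coextension `M × x = (M✶ + x)✶` of `M` by the element `x ∉ M.E`. -/
def IsFreeCoextension {α : Type u} (M : Matroid α) (x : α) (N : Matroid α) : Prop :=
  M✶.IsFreeExtension x N✶

/-- `M.Yields N`: up to isomorphism, `N` can be obtained from `M` by some combination of minors,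
free extensions and free coextensions. (The matroids on the way may live on any type of the
universe, so that there are always new elements for an extension or coextension.) -/
inductive Yields {α : Type u} (M : Matroid α) : {β : Type u} → Matroid β → Prop
  | refl : Yields M M
  | iso {β γ : Type u} {N : Matroid β} {N' : Matroid γ} :
      Yields M N → N.IsIsomorphic N' → Yields M N'
  | minor {β : Type u} {N N' : Matroid β} : Yields M N → N' ≤m N → Yields M N'
  | freeExtension {β : Type u} {N N' : Matroid β} (x : β) :
      Yields M N → N.IsFreeExtension x N' → Yields M N'
  | freeCoextension {β : Type u} {N N' : Matroid β} (x : β) :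
      Yields M N → N.IsFreeCoextension x N' → Yields M N'

/-- `M` is the matroid `M_k(M₁, S₁', T₁; M₂, S₂', T₂)`: the matroid of rank `k` on
`S₁ ∪ S₂ ∪ T₁ ∪ T₂` (where `Sᵢ` is the ground set of `Mᵢ`) whose cyclic flats, with their ranks,
are `∅` of rank `0`, the whole ground set of rank `k`, the sets `F ∪ T₁ ∪ S₂'` of rank
`r₁(F) + |T₁| + |S₂'|` for `F ∈ 𝒵'(M₁)`, and the sets `F ∪ T₂ ∪ S₁'` of rank
`r₂(F) + |T₂| + |S₁'|` for `F ∈ 𝒵'(M₂)`. -/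
structure IsIntertwineConstruction {α : Type u} (M : Matroid α) (k : ℕ)
    (M₁ : Matroid α) (S₁' T₁ : Set α) (M₂ : Matroid α) (S₂' T₂ : Set α) : Prop where
  ground_eq : M.E = M₁.E ∪ M₂.E ∪ T₁ ∪ T₂
  isCyclicFlat_iff : ∀ Z, M.IsCyclicFlat Z ↔
    Z = ∅ ∨ Z = M₁.E ∪ M₂.E ∪ T₁ ∪ T₂ ∨
      (∃ F, M₁.IsNonemptyProperCyclicFlat F ∧ Z = F ∪ T₁ ∪ S₂') ∨
      (∃ F, M₂.IsNonemptyProperCyclicFlat F ∧ Z = F ∪ T₂ ∪ S₁')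
  eRk_left : ∀ F, M₁.IsNonemptyProperCyclicFlat F →
    M.eRk (F ∪ T₁ ∪ S₂') = M₁.eRk F + T₁.encard + S₂'.encard
  eRk_right : ∀ F, M₂.IsNonemptyProperCyclicFlat F →
    M.eRk (F ∪ T₂ ∪ S₁') = M₂.eRk F + T₂.encard + S₁'.encard
  eRk_empty : M.eRk ∅ = 0
  eRank_eq : M.eRank = k

end Matroid

open Set

namespace Matroid

/-! Put `A₁ = T₁ ∪ S₂'`, `U₁ = T₂ ∪ (S₂ \ S₂')`, and symmetrically `A₂`, `U₂`. Coextending `Mᵢ`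
freely by `Aᵢ` and then extending freely by `Uᵢ` gives a rank-`k` matroid `Nᵢ` in which a set `X`
has rank `min |X|, k, rᵢ(X) + |Aᵢ| + |X ∩ Uᵢ|`. Both `Nᵢ` live on the same set, and `M` is the
matroid whose rank function is the pointwise minimum of theirs. This minimum is submodular because
`k` is large: outside `S₁ ∪ S₂` every element lies in `U₁` or `U₂`, so the two nontrivial terms
cannot both be small (`IsLiftPair.exists_isLiftMeet`). A nonempty proper cyclic flat of `M` must
attain one of the two terms, which forces it to be `F ∪ Aᵢ` (`IsLiftMeet.isCyclicFlat_iff`).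
Uniqueness holds because cyclic flats and their ranks determine a matroid.

For the intertwine property, `M ／ A₁ ＼ U₁ = M₁`. Let `M ／ C ＼ D`, with `C` independent and `D`
coindependent, be any minor isomorphic to `M₁`. By size, `C` makes one of the two terms irrelevant.
If only the `M₂` term survives, the minor comes from `N₂`, so `M₂` yields `M₁`, which is excluded.
Otherwise the minor comes from `N₁`, its nonempty proper cyclic flats are traces of sets `F ∪ A₁`,
and an isomorphism with `M₁` permutes the flats `F`. Summing ranks and sizes over this permutation
gives `C ⊆ F ∪ A₁` and `D ∩ (F ∪ A₁) = ∅` for all `F`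
(`subset_and_disjoint_of_isIsomorphic_lift_minor`). An element removed on the way to both an
`M₁`-minor and an `M₂`-minor satisfies these constraints on both sides, and the conditions on `FI`
leave no such element. Different `k` give different ranks, hence infinitely many intertwines. -/

/-- The rank of a set in a matroid, as a natural number. -/
noncomputable def rk {α : Type u} (M : Matroid α) (X : Set α) : ℕ := (M.eRk X).toNat

/-! ### Natural-number rank functions of finite-rank matroids -/

section Rank

variable {α : Type u} {M : Matroid α} {X Y I C D : Set α}

lemma coe_rk (M : Matroid α) [M.RankFinite] (X : Set α) : (M.rk X : ℕ∞) = M.eRk X :=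
  ENat.natCast_toNat (eRk_ne_top_iff.2 (M.isRkFinite_set X))

lemma rk_mono (M : Matroid α) [M.RankFinite] (h : X ⊆ Y) : M.rk X ≤ M.rk Y := by
  have := M.eRk_mono h
  rw [← coe_rk, ← coe_rk] at this
  exact_mod_cast this

lemma rk_le_ncard (M : Matroid α) [M.RankFinite] (hX : X.Finite) : M.rk X ≤ X.ncard := by
  have := M.eRk_le_encard X
  rw [← coe_rk, ← hX.cast_ncard_eq] at this
  exact_mod_cast this

lemma rk_submod (M : Matroid α) [M.RankFinite] (X Y : Set α) :
    M.rk (X ∩ Y) + M.rk (X ∪ Y) ≤ M.rk X + M.rk Y := by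
  have := M.eRk_inter_add_eRk_union_le X Y
  simp only [← coe_rk] at this
  exact_mod_cast this

lemma rk_insert_le (M : Matroid α) [M.RankFinite] (e : α) (X : Set α) :
    M.rk (insert e X) ≤ M.rk X + 1 := by
  have := M.eRk_insert_le_add_one e X
  simp only [← coe_rk] at this
  exact_mod_cast this

lemma rk_union_le (M : Matroid α) [M.RankFinite] (X : Set α) (hY : Y.Finite) :
    M.rk (X ∪ Y) ≤ M.rk X + Y.ncard := by
  have := M.eRk_union_le_eRk_add_encard X Y
  simp only [← coe_rk, ← hY.cast_ncard_eq] at this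
  exact_mod_cast this

@[simp] lemma rk_inter_ground (M : Matroid α) (X : Set α) : M.rk (X ∩ M.E) = M.rk X := by
  simp [rk]

lemma rk_congr_inter (M : Matroid α) (h : X ∩ M.E = Y ∩ M.E) : M.rk X = M.rk Y := by
  rw [← rk_inter_ground, h, rk_inter_ground]

lemma rk_le_rk_ground (M : Matroid α) [M.RankFinite] (X : Set α) : M.rk X ≤ M.rk M.E := by
  rw [← rk_inter_ground]
  exact M.rk_mono inter_subset_right

@[simp] lemma rk_empty (M : Matroid α) : M.rk ∅ = 0 := by simp [rk]

lemma indep_iff_rk [M.RankFinite] (hI : I.Finite) : M.Indep I ↔ M.rk I = I.ncard := by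
  rw [indep_iff_eRk_eq_encard_of_finite hI, ← coe_rk, ← hI.cast_ncard_eq]
  norm_cast

lemma ext_rk {M N : Matroid α} [M.Finite] (hE : M.E = N.E)
    (h : ∀ X ⊆ M.E, M.rk X = N.rk X) : M = N := by
  have : N.Finite := ⟨hE ▸ M.ground_finite⟩
  refine ext_indep hE fun I hI ↦ ?_
  rw [indep_iff_rk (M.ground_finite.subset hI), indep_iff_rk (M.ground_finite.subset hI), h I hI]

lemma rk_dual (M : Matroid α) [M.Finite] (hX : X ⊆ M.E) :
    M✶.rk X + M.rk M.E = M.rk (M.E \ X) + X.ncard := by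
  have := M.eRk_dual_add_eRank X hX
  rw [← eRk_ground, ← coe_rk, ← coe_rk, ← coe_rk,
    ← (M.ground_finite.subset hX).cast_ncard_eq] at this
  exact_mod_cast this

lemma rk_contract_delete [M.Finite] (hC : M.Indep C) (hX : X ⊆ (M ／ C ＼ D).E) :
    (M ／ C ＼ D).rk X + C.ncard = M.rk (X ∪ C) := by
  have hXD : X ∩ ((M.E \ C) \ D) = X := inter_eq_self_of_subset_left hX
  have h1 : (M ／ C ＼ D).rk X = (M ／ C).rk X := by
    rw [rk, delete_eq_restrict, restrict_eRk_eq']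
    simp only [contract_ground]
    rw [hXD, rk]
  rw [h1]
  have hX' : X ⊆ (M ／ C).E := hX.trans (delete_subset_ground _ _)
  obtain ⟨J, hJ⟩ := (M ／ C).exists_isBasis X hX'
  have hJC := hC.union_isBasis_union_of_contract_isBasis hJ
  have hd : Disjoint J C :=
    (disjoint_sdiff_left (t := M.E)).mono_left (hJ.indep.subset_ground)
  have : (M ／ C).eRk X + C.encard = M.eRk (X ∪ C) := by
    rw [hJ.eRk_eq_encard, hJC.eRk_eq_encard, encard_union_eq hd]
  have : ((M ／ C).rk X : ℕ∞) + C.ncard = M.rk (X ∪ C) := by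
    rw [coe_rk, coe_rk, (M.ground_finite.subset hC.subset_ground).cast_ncard_eq, this]
  exact_mod_cast this

/-- Contract only a basis `I` of `C`, and delete only a cobasis `J` of the rest. The leftover
elements `K` are coloops of `M ／ I ＼ J`, so they may be contracted instead of deleted. With this
normal form the rank drops by exactly the size of the contracted set. -/
lemma IsMinor.exists_eq_contract_delete_indep_coindep {M N : Matroid α} (h : N ≤m M) :
    ∃ C D, M.Indep C ∧ M.Coindep D ∧ Disjoint C D ∧ N = M ／ C ＼ D := by
  obtain ⟨C, D, hC, hD, hCD, rfl⟩ := h.exists_eq_contract_delete_disjoint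
  obtain ⟨I, hI⟩ := M.exists_isBasis C
  have hIC := hI.subset
  have hDE : (C \ I) ∪ D ⊆ (M ／ I)✶.E := by
    rw [dual_ground, contract_ground]
    tauto_set
  obtain ⟨J, hJ⟩ := (M ／ I)✶.exists_isBasis ((C \ I) ∪ D) hDE
  have hJD : (M ／ I).Coindep J := hJ.indep
  obtain ⟨hJM, hJI⟩ := coindep_contract_iff.1 hJD
  set K := ((C \ I) ∪ D) \ J with hK
  have hKcl : K ⊆ (M ／ I ＼ J).coloops := by
    have := hJ.sdiff_subset_loops_contract
    rwa [← dual_delete, dual_loops] at this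
  have hKi : (M ／ I ＼ J).Indep K := (coloops_indep _).subset hKcl
  have hKJ : Disjoint K J := disjoint_sdiff_left
  refine ⟨I ∪ K, J, ?_, hJM, ?_, ?_⟩
  · have := hKi.of_delete
    rw [hI.indep.contract_indep_iff] at this
    rw [union_comm]; exact this.2
  · exact disjoint_union_left.2 ⟨hJI.symm, hKJ⟩
  · have h1 : (C \ I) ∪ D = J ∪ K := (union_sdiff_cancel hJ.subset).symm
    rw [hI.contract_eq_contract_delete, delete_delete, h1, ← delete_delete,
      ← contract_eq_delete_of_subset_coloops hKcl, ← contract_delete_comm _ hKJ, contract_contract]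

/-- A submodular, monotone, integer-valued function bounded by the cardinality is the rank function
of a matroid. -/
lemma exists_rk_eq {E : Set α} (hE : E.Finite) (r : Set α → ℕ)
    (hle : ∀ X ⊆ E, r X ≤ X.ncard) (hmono : ∀ X Y, X ⊆ Y → Y ⊆ E → r X ≤ r Y)
    (hsub : ∀ X Y, X ⊆ E → Y ⊆ E → r (X ∩ Y) + r (X ∪ Y) ≤ r X + r Y) :
    ∃ M : Matroid α, M.E = E ∧ ∀ X ⊆ E, M.rk X = r X := by
  -- Elements that do not raise the value one at a time do not raise it together. This gives both
  -- the augmentation axiom and the identification of `r` with the rank.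
  have hext : ∀ X J : Set α, X ⊆ E → J ⊆ E → (∀ e ∈ J, r (insert e X) = r X) →
      r (X ∪ J) = r X := by
    intro X J hX hJ h
    induction J, hE.subset hJ using Set.Finite.induction_on with
    | empty => simp
    | @insert a s has hs ih =>
      rw [insert_subset_iff] at hJ
      have ih := ih hJ.2 fun e he ↦ h e (mem_insert_of_mem _ he)
      have h1 := hsub (X ∪ s) (insert a X) (union_subset hX hJ.2) (insert_subset hJ.1 hX)
      have h2 : (X ∪ s) ∪ insert a X = X ∪ insert a s := by ext; simp; tauto
      rw [h2, ih, h a (mem_insert _ _)] at h1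
      have h3 := hmono X ((X ∪ s) ∩ insert a X)
        (subset_inter subset_union_left (subset_insert _ _))
        (inter_subset_right.trans (insert_subset hJ.1 hX))
      have h4 := hmono X (X ∪ insert a s) subset_union_left
        (union_subset hX (insert_subset hJ.1 hJ.2))
      lia
  have h0 : r ∅ = 0 := by simpa using hle ∅ (empty_subset _)
  have hunion : ∀ X Y, X ⊆ E → Y ⊆ E → r (X ∪ Y) ≤ r X + Y.ncard := fun X Y hX hY ↦ by
    have := hsub X Y hX hY
    have := hle Y hY
    lia
  let N := IndepMatroid.ofFinite hE (fun I ↦ I ⊆ E ∧ r I = I.ncard) ⟨empty_subset _, by simpa⟩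
    (by
      rintro I J ⟨hJ, hrJ⟩ hIJ
      refine ⟨hIJ.trans hJ, (hle I (hIJ.trans hJ)).antisymm ?_⟩
      have h1 := hunion I (J \ I) (hIJ.trans hJ) (sdiff_subset.trans hJ)
      rw [union_sdiff_cancel hIJ, hrJ] at h1
      have := ncard_sdiff_add_ncard_of_subset hIJ (hE.subset hJ)
      lia)
    (by
      rintro I J ⟨hI, hrI⟩ ⟨hJ, hrJ⟩ hlt
      by_contra! hcon
      have : r (I ∪ J) = r I := by
        refine hext I J hI hJ fun e he ↦ ?_
        by_cases heI : e ∈ I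
        · rw [insert_eq_of_mem heI]
        have h1 := hcon e he heI
        have h2 : insert e I ⊆ E := insert_subset (hJ he) hI
        have h3 := hle _ h2
        have h4 := hmono I (insert e I) (subset_insert _ _) h2
        rw [ncard_insert_of_notMem heI (hE.subset hI)] at h1 h3
        have h5 : r (insert e I) ≠ I.ncard + 1 := fun h ↦ h1 h2 h
        lia
      have := hmono J (I ∪ J) subset_union_right (union_subset hI hJ)
      lia)
    (fun I h ↦ h.1)
  refine ⟨N.matroid, rfl, fun X hX ↦ ?_⟩
  have hfin : N.matroid.Finite := ⟨hE⟩
  obtain ⟨I, hI⟩ := N.matroid.exists_isBasis X hX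
  have hIr : r I = I.ncard := hI.indep.2
  have hIE : I ⊆ E := hI.indep.1
  have h1 : N.matroid.rk X = I.ncard := by rw [rk, hI.eRk_eq_encard]; rfl
  rw [h1, ← hIr, ← union_eq_self_of_subset_left hI.subset]
  refine (hext I X hIE hX fun e he ↦ ?_).symm
  by_cases heI : e ∈ I
  · rw [insert_eq_of_mem heI]
  have h2 : insert e I ⊆ E := insert_subset (hX he) hIE
  have h3 := hle _ h2
  have h4 := hmono I (insert e I) (subset_insert _ _) h2
  have h5 : ¬ N.matroid.Indep (insert e I) := fun h ↦
    heI (hI.mem_of_insert_indep he h)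
  have h6 : ¬ (insert e I ⊆ E ∧ r (insert e I) = (insert e I).ncard) := h5
  rw [ncard_insert_of_notMem heI (hE.subset hIE)] at h3 h6
  have h7 : r (insert e I) ≠ I.ncard + 1 := fun h ↦ h6 ⟨h2, h⟩
  lia

end Rank

/-! ### Cyclic flats and how they determine the matroid -/

section CyclicFlat

variable {α : Type u} {M : Matroid α} {F X A : Set α}

lemma mem_closure_iff_rk [M.Finite] {e : α} (he : e ∈ M.E) :
    e ∈ M.closure X ↔ M.rk (insert e X) = M.rk X := by
  constructor
  · intro h
    rw [rk, rk, ← eRk_closure_eq, closure_insert_eq_of_mem_closure h, eRk_closure_eq]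
  · intro h
    by_contra hcon
    have := M.eRk_insert_eq_add_one ⟨he, hcon⟩
    rw [← coe_rk, ← coe_rk, h] at this
    have : M.rk X = M.rk X + 1 := by exact_mod_cast this
    lia

/-- A set is a union of circuits exactly when its restriction has no coloop, so the two rank
conditions express "flat" and "cyclic" respectively. -/
lemma isCyclicFlat_iff_rk [M.Finite] : M.IsCyclicFlat F ↔ F ⊆ M.E ∧
    (∀ e ∈ M.E \ F, M.rk F < M.rk (insert e F)) ∧ ∀ e ∈ F, M.rk (F \ {e}) = M.rk F := by
  constructor
  · rintro ⟨hF, 𝒞, h𝒞, hU⟩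
    have hFE := hF.subset_ground
    refine ⟨hFE, fun e he ↦ ?_, fun e he ↦ ?_⟩
    · have h1 := M.rk_mono (subset_insert e F)
      refine h1.lt_of_ne fun h ↦ he.2 ?_
      rw [← hF.closure]
      exact (mem_closure_iff_rk he.1).2 h.symm
    · have he' := he
      rw [hU] at he'
      obtain ⟨C, hC, heC⟩ := he'
      have h1 := (h𝒞 C hC).mem_closure_sdiff_singleton_of_mem heC
      have h2 : C \ {e} ⊆ F \ {e} := by
        refine sdiff_subset_sdiff_left ?_
        rw [hU]; exact subset_sUnion_of_mem hC
      have h3 := (mem_closure_iff_rk (hFE he)).1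
        (M.closure_subset_closure h2 h1)
      rw [← h3, insert_sdiff_singleton, insert_eq_of_mem he]
  · rintro ⟨hFE, h1, h2⟩
    refine ⟨?_, {C | M.IsCircuit C ∧ C ⊆ F}, fun C hC ↦ hC.1, ?_⟩
    · rw [isFlat_iff_closure_eq]
      refine subset_antisymm (fun e he ↦ ?_) (M.subset_closure F hFE)
      by_contra heF
      have heE := mem_ground_of_mem_closure he
      have := h1 e ⟨heE, heF⟩
      rw [(mem_closure_iff_rk heE).1 he] at this
      exact this.false
    · refine subset_antisymm (fun e he ↦ ?_) (sUnion_subset fun C hC ↦ hC.2)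
      have h3 : e ∈ M.closure (F \ {e}) := by
        rw [mem_closure_iff_rk (hFE he), insert_sdiff_singleton,
          insert_eq_of_mem he, h2 e he]
      obtain ⟨C, hC, hCi, heC⟩ := exists_isCircuit_of_mem_closure h3 (by simp)
      refine ⟨C, ⟨hCi, hC.trans ?_⟩, heC⟩
      rw [insert_sdiff_singleton, insert_eq_of_mem he]

lemma IsCyclicFlat.subset_ground (h : M.IsCyclicFlat F) : F ⊆ M.E := h.1.subset_ground

/-- By the dual rank formula, complementation exchanges the flatness condition with the coloop-free
condition. -/
lemma IsCyclicFlat.compl_dual [M.Finite] (h : M.IsCyclicFlat F) : M✶.IsCyclicFlat (M.E \ F) := by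
  have hfin := M.ground_finite
  obtain ⟨hF, h1, h2⟩ := isCyclicFlat_iff_rk.1 h
  have h3 := M.rk_dual (X := M.E \ F) sdiff_subset
  rw [sdiff_sdiff_cancel_left hF] at h3
  refine isCyclicFlat_iff_rk.2 ⟨sdiff_subset, fun e he ↦ ?_, fun e he ↦ ?_⟩
  · have heF : e ∈ F := by
      by_contra heF; exact he.2 ⟨he.1, heF⟩
    have h4 := M.rk_dual (X := insert e (M.E \ F)) (insert_subset he.1 sdiff_subset)
    have h5 : M.E \ insert e (M.E \ F) = F \ {e} := by
      ext x; have := @hF x; simp; tauto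
    rw [h5, h2 e heF, ncard_insert_of_notMem he.2 (hfin.subset sdiff_subset)] at h4
    lia
  · have h4 := M.rk_dual (X := (M.E \ F) \ {e}) (sdiff_subset.trans sdiff_subset)
    have h5 : M.E \ ((M.E \ F) \ {e}) = insert e F := by
      ext x; have := @hF x; have := he.1; simp; grind
    have h6 := ncard_sdiff_singleton_add_one he (hfin.subset sdiff_subset)
    have h7 := h1 e he
    have h8 := M.rk_insert_le e F
    rw [h5] at h4
    lia

lemma rk_le_rk_add_ncard_sdiff (M : Matroid α) [M.Finite] (hA : A.Finite) (F : Set α) :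
    M.rk A ≤ M.rk F + (A \ F).ncard := by
  refine (M.rk_mono ?_).trans (M.rk_union_le F (hA.subset sdiff_subset))
  rw [union_sdiff_self]; exact subset_union_right

/-- With `rk_le_rk_add_ncard_sdiff`, this says that `r(A)` is the minimum of `r(F) + |A \ F|` over
cyclic flats `F`. -/
lemma exists_isCyclicFlat_rk_eq (M : Matroid α) [M.Finite] (hA : A ⊆ M.E) :
    ∃ F, M.IsCyclicFlat F ∧ M.rk A = M.rk F + (A \ F).ncard := by
  have hfin := M.ground_finite
  let S : Set (Set α) := {Y | Y ⊆ M.E ∧ M.rk Y + (A \ Y).ncard ≤ M.rk A}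
  have hS : S.Finite := hfin.finite_subsets.subset fun Y hY ↦ hY.1
  have hne : S.Nonempty := ⟨A, hA, by simp⟩
  -- The weight 2 makes both corrections decrease the potential: adding an element of the closure
  -- lowers it by 1, while removing a coloop changes it by at most `-2 + 1`.
  obtain ⟨Y, ⟨hYE, hYr⟩, hmin⟩ := exists_min_image S (fun Y ↦ 2 * M.rk Y + (M.E \ Y).ncard) hS hne
  refine ⟨Y, isCyclicFlat_iff_rk.2 ⟨hYE, fun e he ↦ ?_, fun e he ↦ ?_⟩,
    (M.rk_le_rk_add_ncard_sdiff (hfin.subset hA) Y).antisymm hYr⟩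
  · by_contra! hcon
    have h1 : insert e Y ∈ S := by
      refine ⟨insert_subset he.1 hYE, ?_⟩
      have := ncard_le_ncard (sdiff_subset_sdiff_right (s := A) (subset_insert e Y))
        (hfin.subset (sdiff_subset.trans hA))
      lia
    have h2 := hmin _ h1
    have h3 : M.E \ insert e Y = (M.E \ Y) \ {e} := by ext; simp; tauto
    have h4 := ncard_sdiff_singleton_add_one he (hfin.subset sdiff_subset)
    simp only [h3] at h2
    lia
  · by_contra hcon
    have h0 := M.rk_mono (sdiff_subset (s := Y) (t := {e}))
    have h3 : A \ (Y \ {e}) ⊆ insert e (A \ Y) := by intro x; simp; tauto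
    have h3' := (ncard_le_ncard h3 ((hfin.subset (sdiff_subset.trans hA)).insert e)).trans
      (ncard_insert_le _ _)
    have h1 : Y \ {e} ∈ S := by
      refine ⟨sdiff_subset.trans hYE, ?_⟩
      lia
    have h2 := hmin _ h1
    have h4 : M.E \ (Y \ {e}) ⊆ insert e (M.E \ Y) := by intro x; simp; tauto
    have h4' := (ncard_le_ncard h4 ((hfin.subset sdiff_subset).insert e)).trans
      (ncard_insert_le _ _)
    lia

lemma ext_isCyclicFlat {M N : Matroid α} [M.Finite] (hE : M.E = N.E)
    (hZ : ∀ F, M.IsCyclicFlat F ↔ N.IsCyclicFlat F)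
    (hr : ∀ F, M.IsCyclicFlat F → M.rk F = N.rk F) : M = N := by
  have : N.Finite := ⟨hE ▸ M.ground_finite⟩
  refine ext_rk hE fun X hX ↦ ?_
  have hXf := M.ground_finite.subset hX
  obtain ⟨F, hF, hF'⟩ := M.exists_isCyclicFlat_rk_eq hX
  obtain ⟨G, hG, hG'⟩ := N.exists_isCyclicFlat_rk_eq (hE ▸ hX)
  have h1 := M.rk_le_rk_add_ncard_sdiff hXf G
  have h2 := N.rk_le_rk_add_ncard_sdiff hXf F
  have h3 := hr F hF
  have h4 := hr G ((hZ G).2 hG)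
  lia

lemma IsNonemptyProperCyclicFlat.rk_lt_ncard [M.Finite] (h : M.IsNonemptyProperCyclicFlat F) :
    M.rk F < F.ncard := by
  obtain ⟨hF, ⟨e, he⟩, -⟩ := h
  have hfin := M.ground_finite.subset hF.subset_ground
  have h1 := (isCyclicFlat_iff_rk.1 hF).2.2 e he
  have h2 := M.rk_le_ncard (hfin.subset (sdiff_subset (t := {e})))
  have h3 := ncard_sdiff_singleton_add_one he hfin
  lia

lemma IsNonemptyProperCyclicFlat.rk_lt_rk_ground [M.Finite]
    (h : M.IsNonemptyProperCyclicFlat F) : M.rk F < M.rk M.E := by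
  obtain ⟨hF, -, hne⟩ := h
  obtain ⟨e, he⟩ := exists_of_ssubset (hF.subset_ground.ssubset_of_ne hne)
  exact ((isCyclicFlat_iff_rk.1 hF).2.1 e he).trans_le (M.rk_le_rk_ground _)

end CyclicFlat

/-! ### Rank functions of free extensions, free coextensions and their iterates -/

section FreeExtension

variable {α : Type u} {M : Matroid α} {X B C A U : Set α} {x : α}

lemma isBase_iff_rk [M.Finite] (hB : B ⊆ M.E) :
    M.IsBase B ↔ M.Indep B ∧ M.rk M.E ≤ B.ncard := by
  have hfin := M.ground_finite.subset hB
  refine ⟨fun h ↦ ⟨h.indep, ?_⟩, fun ⟨h, h'⟩ ↦ h.isBase_of_eRk_ge hfin ?_⟩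
  · rw [← (indep_iff_rk hfin).1 h.indep, rk, rk, h.eRk_eq_eRank, eRk_ground]
  · rw [← eRk_ground, ← coe_rk, ← coe_rk, (indep_iff_rk hfin).1 h]
    exact_mod_cast h'

lemma isCircuit_iff_indep (hC : C ⊆ M.E) :
    M.IsCircuit C ↔ ¬ M.Indep C ∧ ∀ e ∈ C, M.Indep (C \ {e}) := by
  rw [isCircuit_iff_dep_forall_sdiff_singleton_indep, dep_iff, and_iff_left hC]

/-- The free extension is `M` with a coloop `x` added, truncated back to the rank of `M`; hence the
formula. -/
lemma exists_isFreeExtension (M : Matroid α) [M.Finite] (hx : x ∉ M.E) :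
    ∃ N : Matroid α, M.IsFreeExtension x N ∧ N.Finite ∧
      ∀ X ⊆ insert x M.E, N.rk X = min (M.rk X + (X ∩ {x}).ncard) (M.rk M.E) := by
  have hfin := M.ground_finite
  have hE := hfin.insert x
  have hsx : ∀ X : Set α, (X ∩ {x}).Finite := fun X ↦ (finite_singleton x).subset inter_subset_right
  obtain ⟨N, hNE, hN⟩ := exists_rk_eq hE
    (fun X ↦ min (M.rk X + (X ∩ {x}).ncard) (M.rk M.E))
    (fun X hX ↦ by
      have hXf := hE.subset hX
      have h1 : M.rk X ≤ (X \ {x}).ncard := by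
        rw [← rk_inter_ground]
        refine (M.rk_le_ncard (hXf.subset inter_subset_left)).trans
          (ncard_le_ncard (fun y hy ↦ ⟨hy.1, ?_⟩) (hXf.subset sdiff_subset))
        rintro rfl; exact hx hy.2
      have := ncard_inter_add_ncard_sdiff_eq_ncard X {x} hXf
      lia)
    (fun X Y hXY hY ↦ by
      have h1 := M.rk_mono hXY
      have h2 := ncard_le_ncard (inter_subset_inter_left {x} hXY) (hsx Y)
      lia)
    (fun X Y hX hY ↦ by
      have h1 := M.rk_submod X Y
      have h2 := ncard_union_add_ncard_inter (X ∩ {x}) (Y ∩ {x}) (hsx X) (hsx Y)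
      rw [← union_inter_distrib_right, ← inter_inter_distrib_right] at h2
      have h3 := M.rk_mono (inter_subset_left (s := X) (t := Y))
      have h4 := M.rk_mono (inter_subset_right (s := X) (t := Y))
      have h5 := ncard_le_ncard (inter_subset_inter_left {x} (inter_subset_left (s := X) (t := Y)))
        (hsx X)
      have h6 := ncard_le_ncard (inter_subset_inter_left {x} (inter_subset_right (s := X) (t := Y)))
        (hsx Y)
      lia)
  have hNfin : N.Finite := ⟨hNE ▸ hE⟩
  refine ⟨N, ⟨hx, hNE, fun C ↦ ?_⟩, hNfin, hN⟩
  have hi : ∀ I ⊆ M.E, (N.Indep I ↔ M.Indep I) := fun I hI ↦ by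
    have hIf := hfin.subset hI
    have h1 : I ∩ {x} = ∅ := by
      rw [inter_singleton_eq_empty]; exact fun h ↦ hx (hI h)
    have h2 := M.rk_le_rk_ground I
    rw [indep_iff_rk hIf, indep_iff_rk hIf, hN I (hI.trans (subset_insert _ _)), h1, ncard_empty,
      add_zero, min_eq_left h2]
  have hi' : ∀ I ⊆ M.E, (N.Indep (insert x I) ↔ M.Indep I ∧ ¬ M.IsBase I) := fun I hI ↦ by
    have hIf := hfin.subset hI
    have hxI : x ∉ I := fun h ↦ hx (hI h)
    have h1 : insert x I ∩ {x} = {x} := by simp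
    have h2 : M.rk (insert x I) = M.rk I :=
      M.rk_congr_inter (by rw [insert_inter_of_notMem hx])
    have h3 := M.rk_le_ncard hIf
    rw [isBase_iff_rk hI, indep_iff_rk hIf, indep_iff_rk (hIf.insert x),
      hN _ (insert_subset_insert hI), h1, h2, ncard_singleton, ncard_insert_of_notMem hxI hIf]
    lia
  by_cases hxC : x ∈ C
  · have hCx : insert x (C \ {x}) = C := by rw [insert_sdiff_singleton, insert_eq_of_mem hxC]
    constructor
    · intro hC
      have hCE : C \ {x} ⊆ M.E := by
        have := hC.subset_ground
        rw [hNE] at this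
        rintro y ⟨hy, hyx⟩
        exact (this hy).resolve_left hyx
      have h1 := (hi _ hCE).1 (hC.sdiff_singleton_indep hxC)
      have h2 := hC.not_indep
      rw [← hCx, hi' _ hCE] at h2
      exact .inr ⟨C \ {x}, by tauto, hCx.symm⟩
    · rintro (hC | ⟨B, hB, rfl⟩)
      · exact (hx (hC.subset_ground hxC)).elim
      · have hBE := hB.subset_ground
        have hxB : x ∉ B := fun h ↦ hx (hBE h)
        rw [isCircuit_iff_indep (by rw [hNE]; exact insert_subset_insert hBE), hi' _ hBE]
        refine ⟨by tauto, ?_⟩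
        rintro e (rfl | he)
        · rw [insert_sdiff_self_of_notMem hxB, hi _ hBE]; exact hB.indep
        · have hex : e ≠ x := by rintro rfl; exact hxB he
          rw [← insert_sdiff_singleton_comm hex.symm, hi' _ (sdiff_subset.trans hBE)]
          refine ⟨hB.indep.subset sdiff_subset, fun h ↦ ?_⟩
          have := h.eq_of_subset_isBase hB sdiff_subset
          rw [← this] at he
          exact he.2 rfl
  · have hor : (M.IsCircuit C ∨ ∃ B, M.IsBase B ∧ C = insert x B) ↔ M.IsCircuit C := by
      refine or_iff_left ?_
      rintro ⟨B, -, rfl⟩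
      exact hxC (mem_insert _ _)
    rw [hor]
    by_cases hCE : C ⊆ M.E
    · rw [isCircuit_iff_indep hCE, isCircuit_iff_indep (by rw [hNE]; exact hCE.trans (subset_insert _ _)),
        hi _ hCE]
      refine and_congr_right fun _ ↦ forall₂_congr fun e _ ↦ hi _ (sdiff_subset.trans hCE)
    · refine iff_of_false (fun h ↦ hCE fun y hy ↦ ?_) (fun h ↦ hCE h.subset_ground)
      have := h.subset_ground hy
      rw [hNE] at this
      exact this.resolve_left (by rintro rfl; exact hxC hy)

lemma exists_isFreeCoextension (M : Matroid α) [M.Finite] (hx : x ∉ M.E) :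
    ∃ N : Matroid α, M.IsFreeCoextension x N ∧ N.Finite ∧ N.E = insert x M.E ∧
      ∀ X ⊆ insert x M.E, N.rk X = min X.ncard (M.rk X + 1) := by
  have hfin := M.ground_finite
  obtain ⟨N, hN, hNfin, hr⟩ := M✶.exists_isFreeExtension hx
  have hNE : N.E = insert x M.E := hN.ground_eq
  rw [dual_ground] at hr
  refine ⟨N✶, by rwa [IsFreeCoextension, dual_dual], inferInstance, hNE, fun X hX ↦ ?_⟩
  have hXf := (hfin.insert x).subset hX
  have h1 := N.rk_dual (X := X) (hNE ▸ hX)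
  rw [hNE, hr _ sdiff_subset, hr _ Subset.rfl] at h1
  have h2 : M✶.rk (insert x M.E) = M✶.rk M.E :=
    rk_congr_inter _ (by simp [insert_inter_of_notMem hx])
  have h3 : insert x M.E ∩ {x} = {x} := by simp
  have h5 := M.rk_dual (X := M.E \ X) sdiff_subset
  have h6 : M.E \ (M.E \ X) = X ∩ M.E := by rw [sdiff_sdiff_right_self, inter_comm]
  rw [h6, rk_inter_ground] at h5
  have h7 : M✶.rk (insert x M.E \ X) = M✶.rk (M.E \ X) := by
    refine rk_congr_inter _ ?_
    ext y; simp only [dual_ground, mem_inter_iff, mem_sdiff, mem_insert_iff]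
    constructor
    · rintro ⟨⟨rfl | h, h'⟩, h''⟩ <;> tauto
    · tauto
  have h8 := M.rk_dual (X := M.E) Subset.rfl
  rw [sdiff_self, rk_empty] at h8
  rw [h2, h3, h7, ncard_singleton] at h1
  have h9 := ncard_inter_add_ncard_sdiff_eq_ncard M.E X hfin
  have h10 := M.rk_le_ncard (hXf.subset (inter_subset_left (t := M.E)))
  rw [rk_inter_ground] at h10
  have h12 : M.rk M.E ≤ M.rk X + (M.E \ X).ncard := M.rk_le_rk_add_ncard_sdiff hfin X
  rw [inter_comm] at h9
  by_cases hxX : x ∈ X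
  · have h11 : X = insert x (X ∩ M.E) := by
      ext y
      have := @hX y
      simp only [mem_insert_iff, mem_inter_iff] at this ⊢
      constructor
      · tauto
      · rintro (rfl | h)
        · exact hxX
        · exact h.1
    have h13 : (insert x M.E \ X) ∩ {x} = ∅ := by simp [hxX]
    have h14 : X.ncard = (X ∩ M.E).ncard + 1 := by
      conv_lhs => rw [h11]
      exact ncard_insert_of_notMem (fun h ↦ hx h.2) (hXf.subset inter_subset_left)
    rw [h13, ncard_empty] at h1
    lia
  · have h11 : X ∩ M.E = X := by
      refine inter_eq_self_of_subset_left fun y hy ↦ (hX hy).resolve_left ?_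
      rintro rfl; exact hxX hy
    have h13 : (insert x M.E \ X) ∩ {x} = {x} := by simp [hxX]
    rw [h13, ncard_singleton] at h1
    rw [h11] at h9 h10
    lia

/-- The function that, for `X` inside `M.E ∪ A ∪ U`, gives the rank of `X` in the free coextension
of `M` by `A` and free extension by `U`, before truncation to the cardinality of `X` and to the
total rank. -/
noncomputable def liftRk (M : Matroid α) (A U X : Set α) : ℕ := M.rk X + A.ncard + (X ∩ U).ncard

lemma exists_yields_coextension (M : Matroid α) [M.Finite] (hA : A.Finite)
    (hd : Disjoint A M.E) : ∃ N : Matroid α, M.Yields N ∧ N.Finite ∧ N.E = M.E ∪ A ∧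
      ∀ X ⊆ N.E, N.rk X = min X.ncard (M.rk X + A.ncard) := by
  have hfin := M.ground_finite
  induction A, hA using Set.Finite.induction_on with
  | empty =>
    refine ⟨M, .refl, inferInstance, by simp, fun X hX ↦ ?_⟩
    have := M.rk_le_ncard (hfin.subset hX)
    simpa using this
  | @insert a s has hs ih =>
    rw [disjoint_insert_left] at hd
    obtain ⟨N, hMN, hNfin, hNE, hr⟩ := ih hd.2
    have haN : a ∉ N.E := by rw [hNE]; simp [has, hd.1]
    obtain ⟨N', hN', hfin', hNE', hr'⟩ := N.exists_isFreeCoextension haN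
    refine ⟨N', .freeCoextension a hMN hN', hfin', by rw [hNE', hNE, union_insert], fun X hX ↦ ?_⟩
    rw [hNE'] at hX
    have hXf := (N.ground_finite.insert a).subset hX
    have h1 : M.rk (X ∩ N.E) = M.rk X := by
      refine M.rk_congr_inter ?_
      rw [inter_assoc, inter_eq_self_of_subset_right (s := N.E)]
      rw [hNE]; exact subset_union_left
    have h2 : X ⊆ insert a (X ∩ N.E) := fun y hy ↦ by
      have := hX hy
      simp only [mem_insert_iff, mem_inter_iff] at this ⊢
      tauto
    have h3 := (ncard_le_ncard h2 ((hXf.subset inter_subset_left).insert a)).trans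
      (ncard_insert_le _ _)
    rw [hr' X hX, ← N.rk_inter_ground X, hr _ inter_subset_right, h1,
      ncard_insert_of_notMem has hs]
    lia

lemma exists_yields_lift (M : Matroid α) [M.Finite] (hA : A.Finite) (hU : U.Finite)
    (hAE : Disjoint A M.E) (hUE : Disjoint U M.E) (hAU : Disjoint A U) :
    ∃ N : Matroid α, M.Yields N ∧ N.Finite ∧ N.E = M.E ∪ A ∪ U ∧
      ∀ X ⊆ N.E, N.rk X = min X.ncard (min (M.liftRk A U X) (M.rk M.E + A.ncard)) := by
  have hfin := M.ground_finite
  induction U, hU using Set.Finite.induction_on with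
  | empty =>
    obtain ⟨N, h1, h2, h3, h4⟩ := M.exists_yields_coextension hA hAE
    refine ⟨N, h1, h2, by simpa using h3, fun X hX ↦ ?_⟩
    have := M.rk_le_rk_ground X
    simp [h4 X hX, liftRk, this]
  | @insert a s has hs ih =>
    rw [disjoint_insert_left] at hUE
    rw [disjoint_insert_right] at hAU
    obtain ⟨N, hMN, hNfin, hNE, hr⟩ := ih hUE.2 hAU.2
    have haN : a ∉ N.E := by rw [hNE]; simp [has, hUE.1, hAU.1]
    obtain ⟨N', hN', hfin', hr'⟩ := N.exists_isFreeExtension haN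
    have hNE' := hN'.ground_eq
    refine ⟨N', .freeExtension a hMN hN', hfin', by rw [hNE', hNE, union_insert], fun X hX ↦ ?_⟩
    rw [hNE'] at hX
    have hXf := (N.ground_finite.insert a).subset hX
    have h1 : M.rk (X ∩ N.E) = M.rk X := by
      refine M.rk_congr_inter ?_
      rw [inter_assoc, inter_eq_self_of_subset_right (s := N.E)]
      rw [hNE, union_assoc]; exact subset_union_left
    have h1' : M.rk N.E = M.rk M.E := by
      refine M.rk_congr_inter ?_
      rw [inter_self, inter_eq_right, hNE, union_assoc]; exact subset_union_left
    have h2 : X ∩ N.E ∩ s = X ∩ s := by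
      rw [inter_assoc, inter_eq_self_of_subset_right (s := N.E)]
      rw [hNE]; exact subset_union_right
    have h2' : N.E ∩ s = s := by
      rw [inter_eq_right, hNE]; exact subset_union_right
    have h3 : (X ∩ N.E).ncard + (X ∩ {a}).ncard = X.ncard := by
      rw [← ncard_union_eq _ (hXf.subset inter_subset_left) (hXf.subset inter_subset_left),
        ← inter_union_distrib_left, union_singleton, inter_eq_self_of_subset_left hX]
      refine Disjoint.mono inter_subset_right inter_subset_right ?_
      simpa using haN
    have h4 : (X ∩ insert a s).ncard = (X ∩ s).ncard + (X ∩ {a}).ncard := by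
      rw [← ncard_union_eq _ (hXf.subset inter_subset_left) (hXf.subset inter_subset_left),
        ← inter_union_distrib_left, union_singleton]
      refine Disjoint.mono inter_subset_right inter_subset_right ?_
      simpa using has
    have h5 : M.rk M.E + A.ncard ≤ N.E.ncard := by
      have : (M.E ∪ A).ncard ≤ N.E.ncard :=
        ncard_le_ncard (by rw [hNE]; exact subset_union_left) N.ground_finite
      rw [ncard_union_eq hAE.symm hfin hA] at this
      have := M.rk_le_ncard hfin
      lia
    rw [hr' X hX, ← N.rk_inter_ground X, hr _ inter_subset_right, hr _ Subset.rfl]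
    simp only [liftRk, h1, h1', h2, h2', h4]
    have := M.rk_le_rk_ground X
    lia

end FreeExtension

/-! ### Cyclic flats of minors of lifts -/

section LiftCyclicFlat

variable {α : Type u} {P N : Matroid α} {A U C D F G X : Set α}

lemma ncard_sdiff_union_eq (hX : X ⊆ P.E ∪ A ∪ U) (hXf : X.Finite) (hAE : Disjoint A P.E)
    (hUE : Disjoint U P.E) (hAU : Disjoint A U) (hF : F ⊆ P.E) :
    (X \ (F ∪ A)).ncard = ((X ∩ P.E) \ F).ncard + (X ∩ U).ncard := by
  rw [← ncard_union_eq _ (hXf.subset (sdiff_subset.trans inter_subset_left))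
    (hXf.subset inter_subset_left)]
  · congr 1
    ext x
    have h1 := @hX x
    have h2 := @hF x
    have h3 : x ∈ A → x ∉ P.E := fun h ↦ disjoint_left.1 hAE h
    have h4 : x ∈ U → x ∉ P.E := fun h ↦ disjoint_left.1 hUE h
    have h5 : x ∈ A → x ∉ U := fun h ↦ disjoint_left.1 hAU h
    simp only [mem_union, mem_sdiff, mem_inter_iff] at *
    tauto
  · refine Disjoint.mono (sdiff_subset.trans inter_subset_right) inter_subset_right hUE.symm

/-- Together with `exists_liftRk_eq`, this writes `liftRk` as a minimum in which the sets `F ∪ A`,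
`F` a cyclic flat of `P`, play the role of cyclic flats. -/
lemma liftRk_le [P.Finite] (hX : X ⊆ P.E ∪ A ∪ U) (hXf : X.Finite) (hAE : Disjoint A P.E)
    (hUE : Disjoint U P.E) (hAU : Disjoint A U) (hF : F ⊆ P.E) :
    P.liftRk A U X ≤ P.rk F + A.ncard + (X \ (F ∪ A)).ncard := by
  have h1 := P.rk_le_rk_add_ncard_sdiff (hXf.subset (inter_subset_left (t := P.E))) F
  rw [rk_inter_ground] at h1
  rw [ncard_sdiff_union_eq hX hXf hAE hUE hAU hF, liftRk]
  lia

lemma exists_liftRk_eq [P.Finite] (hX : X ⊆ P.E ∪ A ∪ U) (hXf : X.Finite) (hAE : Disjoint A P.E)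
    (hUE : Disjoint U P.E) (hAU : Disjoint A U) :
    ∃ F, P.IsCyclicFlat F ∧ P.liftRk A U X = P.rk F + A.ncard + (X \ (F ∪ A)).ncard := by
  obtain ⟨F, hF, hr⟩ := P.exists_isCyclicFlat_rk_eq (A := X ∩ P.E) inter_subset_right
  refine ⟨F, hF, ?_⟩
  rw [rk_inter_ground] at hr
  rw [ncard_sdiff_union_eq hX hXf hAE hUE hAU hF.subset_ground, liftRk]
  lia

/-- If the rank function of `N` is bounded by that of a lift of `P` contracted by `C`, then every
cyclic flat of `N` at which the bound is attained comes from a cyclic flat of `P`. -/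
lemma IsNonemptyProperCyclicFlat.exists_of_liftRk_eq [P.Finite] [N.Finite]
    (hA : A.Finite) (hC : C.Finite) (hAE : Disjoint A P.E) (hUE : Disjoint U P.E)
    (hAU : Disjoint A U) (hCN : Disjoint C N.E) (hsub : N.E ∪ C ⊆ P.E ∪ A ∪ U)
    (hle : ∀ Y ⊆ N.E, N.rk Y + C.ncard ≤ P.liftRk A U (Y ∪ C))
    (hrk : N.rk N.E + C.ncard ≤ P.rk P.E + A.ncard)
    (hG : N.IsNonemptyProperCyclicFlat G) (hGr : N.rk G + C.ncard = P.liftRk A U (G ∪ C)) :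
    ∃ F, P.IsNonemptyProperCyclicFlat F ∧ G = (F ∪ A) ∩ N.E ∧
      N.rk G + C.ncard = P.rk F + A.ncard + (C \ (F ∪ A)).ncard := by
  have hGE := hG.1.subset_ground
  have hNf := N.ground_finite
  have hGf := hNf.subset hGE
  have hcard : ∀ Y ⊆ N.E, ∀ Q : Set α,
      ((Y ∪ C) \ Q).ncard = (Y \ Q).ncard + (C \ Q).ncard := fun Y hY Q ↦ by
    rw [union_sdiff_distrib, ncard_union_eq _ ((hNf.subset hY).subset sdiff_subset)
      (hC.subset sdiff_subset)]
    exact (hCN.symm.mono_left hY).mono sdiff_subset sdiff_subset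
  obtain ⟨F, hF, hFr⟩ := exists_liftRk_eq (P := P) (U := U) (A := A) (X := G ∪ C)
    ((union_subset_union_left C hGE).trans hsub) (hGf.union hC) hAE hUE hAU
  have hub : ∀ Y ⊆ N.E, N.rk Y + C.ncard ≤
      P.rk F + A.ncard + ((Y \ (F ∪ A)).ncard + (C \ (F ∪ A)).ncard) := fun Y hY ↦ by
    rw [← hcard Y hY]
    exact (hle Y hY).trans (liftRk_le ((union_subset_union_left C hY).trans hsub)
      ((hNf.subset hY).union hC) hAE hUE hAU hF.subset_ground)
  rw [hcard G hGE] at hFr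
  obtain ⟨-, hflat, hcyc⟩ := isCyclicFlat_iff_rk.1 hG.1
  -- The bound `hub` is tight at `G`. Removing an element outside `F ∪ A` would lower the bound but,
  -- `G` being cyclic, not the rank. Dually, adding an element of `F ∪ A` keeps the bound, so
  -- flatness gives equality below.
  have hGQ : G ⊆ F ∪ A := by
    intro e he
    by_contra heQ
    have h1 := hub (G \ {e}) (sdiff_subset.trans hGE)
    rw [hcyc e he, sdiff_sdiff_comm] at h1
    have h2 := ncard_sdiff_singleton_add_one (show e ∈ G \ (F ∪ A) from ⟨he, heQ⟩)
      (hGf.subset sdiff_subset)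
    lia
  rw [sdiff_eq_empty.2 hGQ, ncard_empty, zero_add] at hFr
  have hGr' := hGr.trans hFr
  have hGeq : G = (F ∪ A) ∩ N.E := by
    refine subset_antisymm (subset_inter hGQ hGE) fun e he ↦ ?_
    by_contra heG
    have h1 := hub (insert e G) (insert_subset he.2 hGE)
    rw [sdiff_eq_empty.2 (insert_subset he.1 hGQ), ncard_empty] at h1
    have h2 := hflat e ⟨he.2, heG⟩
    lia
  refine ⟨F, ⟨hF, ?_, ?_⟩, hGeq, hGr'⟩
  -- If `F = ∅`, then `G ⊆ A` has rank `|A \ C| ≥ |G|`, so it is independent; this is impossible for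
  -- a nonempty cyclic flat.
  · rw [nonempty_iff_ne_empty]
    rintro rfl
    rw [empty_union] at hGeq hGr'
    have h1 := hG.rk_lt_ncard
    have h2 : G.ncard + (A ∩ C).ncard ≤ A.ncard := by
      rw [← ncard_union_eq _ hGf (hA.subset inter_subset_left)]
      · refine ncard_le_ncard (union_subset ?_ inter_subset_left) hA
        rw [hGeq]; exact inter_subset_left
      · exact (hCN.symm.mono_left hGE).mono_right inter_subset_right
    have h3 := ncard_inter_add_ncard_sdiff_eq_ncard C A hC
    rw [inter_comm] at h3
    rw [rk_empty] at hGr'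
    lia
  · rintro rfl
    have := hG.rk_lt_rk_ground
    lia

end LiftCyclicFlat

/-! ### Isomorphisms and the transport of ranks and cyclic flats -/

section Iso

variable {α : Type u} {β : Type v} {M : Matroid α} {N : Matroid β}

lemma IsIsomorphic.refl (M : Matroid α) : M.IsIsomorphic M := ⟨.refl _, fun I ↦ by simp⟩

lemma IsIsomorphic.symm (h : M.IsIsomorphic N) : N.IsIsomorphic M := by
  obtain ⟨e, he⟩ := h
  exact ⟨e.symm, fun I ↦ by rw [he]; simp⟩

lemma IsIsomorphic.trans {γ : Type*} {K : Matroid γ} (h : M.IsIsomorphic N)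
    (h' : N.IsIsomorphic K) : M.IsIsomorphic K := by
  obtain ⟨e, he⟩ := h
  obtain ⟨f, hf⟩ := h'
  exact ⟨e.trans f, fun I ↦ by rw [he, hf, Equiv.coe_trans, image_comp]⟩

lemma isIsomorphic_map (M : Matroid α) (f : α → β) (hf : InjOn f M.E) :
    M.IsIsomorphic (M.map f hf) := by
  refine ⟨Equiv.Set.imageOfInjOn f M.E hf, fun I ↦ ?_⟩
  have : Subtype.val '' (Equiv.Set.imageOfInjOn f M.E hf '' I) = f '' (Subtype.val '' I) := by
    rw [image_image, image_image]; rfl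
  exact (map_image_indep_iff (by simp)).symm.trans (iff_of_eq (congrArg _ this.symm))

lemma IsIsomorphic.exists_embedding (h : M.IsIsomorphic N) :
    ∃ φ : M.E → β, φ.Injective ∧ range φ = N.E ∧ ∀ X : Set M.E, M.rk (Subtype.val '' X) =
      N.rk (φ '' X) := by
  obtain ⟨e, he⟩ := h
  refine ⟨fun x ↦ e x, Subtype.val_injective.comp e.injective, ?_, fun X ↦ ?_⟩
  · ext y
    refine ⟨?_, fun hy ↦ ⟨e.symm ⟨y, hy⟩, by simp⟩⟩
    rintro ⟨x, rfl⟩; exact (e x).2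
  have h1 : M.comap (Subtype.val : M.E → α) = N.comap (fun x : M.E ↦ (e x : β)) := by
    refine ext_indep (by ext x; simp) fun I _ ↦ ?_
    rw [comap_indep_iff, comap_indep_iff, and_iff_left Subtype.val_injective.injOn,
      and_iff_left (show Function.Injective (fun x : M.E ↦ (e x : β)) from
        Subtype.val_injective.comp e.injective).injOn, he, image_image]
  rw [rk, rk, ← eRk_comap, ← eRk_comap, h1]

lemma IsIsomorphic.rk_ground_eq (h : M.IsIsomorphic N) : M.rk M.E = N.rk N.E := by
  obtain ⟨φ, hφ, hr, h⟩ := h.exists_embedding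
  have := h univ
  simpa [hr] using this

lemma IsIsomorphic.finite (h : M.IsIsomorphic N) [M.Finite] : N.Finite := by
  obtain ⟨e, he⟩ := h
  have : Finite M.E := M.ground_finite
  exact ⟨Finite.of_equiv _ e⟩

/-- An isomorphism carries cyclic flats to cyclic flats, injectively. -/
lemma IsIsomorphic.exists_map_cyclicFlat [M.Finite] (h : M.IsIsomorphic N) :
    ∃ ψ : Set α → Set β, (∀ F F', F ⊆ M.E → F' ⊆ M.E → ψ F = ψ F' → F = F') ∧
      ∀ F, M.IsNonemptyProperCyclicFlat F → N.IsNonemptyProperCyclicFlat (ψ F) ∧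
        (ψ F).ncard = F.ncard ∧ N.rk (ψ F) = M.rk F := by
  have hNfin := h.finite
  obtain ⟨φ, hφ, hrange, hr⟩ := h.exists_embedding
  have hval : ∀ F : Set α, F ⊆ M.E → Subtype.val '' ((↑) ⁻¹' F : Set M.E) = F := fun F hF ↦ by
    rw [Subtype.image_preimage_coe, inter_eq_self_of_subset_right hF]
  have hrk : ∀ F : Set α, F ⊆ M.E → N.rk (φ '' ((↑) ⁻¹' F)) = M.rk F := fun F hF ↦ by
    rw [← hr, hval F hF]
  refine ⟨fun F ↦ φ '' ((↑) ⁻¹' F), fun F F' hF hF' hFF ↦ ?_, ?_⟩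
  · rw [← hval F hF, ← hval F' hF', hφ.image_injective hFF]
  rintro F ⟨hF, hne, hnE⟩
  obtain ⟨hFE, h1, h2⟩ := isCyclicFlat_iff_rk.1 hF
  refine ⟨⟨isCyclicFlat_iff_rk.2 ⟨?_, ?_, ?_⟩, ?_, ?_⟩, ?_, hrk F hFE⟩
  · rw [← hrange]; exact image_subset_range _ _
  · rintro e ⟨heE, heF⟩
    rw [← hrange] at heE
    obtain ⟨x, rfl⟩ := heE
    have hx : (x : α) ∉ F := fun hx ↦ heF ⟨x, hx, rfl⟩
    have h3 : insert (φ x) (φ '' ((↑) ⁻¹' F)) = φ '' ((↑) ⁻¹' (insert (x : α) F)) := by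
      rw [← image_insert_eq]; congr 1; ext y; simp [Subtype.ext_iff]
    rw [h3, hrk F hFE, hrk _ (insert_subset x.2 hFE)]
    exact h1 x ⟨x.2, hx⟩
  · rintro e ⟨x, hx, rfl⟩
    have h3 : (φ '' ((↑) ⁻¹' F)) \ {φ x} = φ '' ((↑) ⁻¹' (F \ {(x : α)})) := by
      rw [← image_singleton, ← image_sdiff hφ]; congr 1; ext y; simp [Subtype.ext_iff]
    rw [h3, hrk F hFE, hrk _ (sdiff_subset.trans hFE)]
    exact h2 x hx
  · obtain ⟨x, hx⟩ := hne
    exact ⟨φ ⟨x, hFE hx⟩, mem_image_of_mem _ hx⟩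
  · intro heq
    rw [← hrange, ← image_univ] at heq
    have := hφ.image_injective heq
    exact hnE (hFE.antisymm fun x hx ↦ this.ge (mem_univ (⟨x, hx⟩ : M.E)))
  · rw [ncard_image_of_injective _ hφ, ← ncard_image_of_injective _ Subtype.val_injective,
      hval F hFE]

end Iso

/-! ### Counting over the permutation of cyclic flats -/

section Counting

variable {α : Type u} {P N : Matroid α} {A U C D F : Set α}

/-- Suppose that `N`, with ground set disjoint from `C ∪ D`, is isomorphic to `P`, and has the rank
function of the minor of a lift of `P` by `A` and `U` obtained by contracting `C` and deleting `D`.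
Then `C` and `D` avoid the obvious copy of `P` as little as the nonempty proper cyclic flats of `P`
allow. -/
lemma subset_and_disjoint_of_isIsomorphic_lift_minor [P.Finite] [N.Finite]
    (hA : A.Finite) (hC : C.Finite) (hAE : Disjoint A P.E) (hUE : Disjoint U P.E)
    (hAU : Disjoint A U) (hCN : Disjoint C N.E) (hDN : Disjoint D N.E) (hCD : Disjoint C D)
    (hE : N.E ∪ C ∪ D = P.E ∪ A ∪ U) (hCA : C.ncard = A.ncard)
    (hle : ∀ Y ⊆ N.E, N.rk Y + C.ncard ≤ P.liftRk A U (Y ∪ C))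
    (hmin : ∀ Y ⊆ N.E, N.rk Y = Y.ncard ∨ N.rk Y = P.rk P.E ∨
      N.rk Y + C.ncard = P.liftRk A U (Y ∪ C))
    (hiso : N.IsIsomorphic P) (hF : P.IsNonemptyProperCyclicFlat F) :
    C ⊆ F ∪ A ∧ Disjoint D (F ∪ A) := by
  have hPf := P.ground_finite
  have hrkE := hiso.rk_ground_eq
  obtain ⟨ψ, hψinj, hψ⟩ := hiso.symm.exists_map_cyclicFlat
  have hfinZ : {F | P.IsNonemptyProperCyclicFlat F}.Finite :=
    hPf.finite_subsets.subset fun Y hY ↦ hY.1.subset_ground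
  have key : ∀ F, P.IsNonemptyProperCyclicFlat F → ∃ F', P.IsNonemptyProperCyclicFlat F' ∧
      ψ F = (F' ∪ A) ∩ N.E ∧ P.rk F = P.rk F' + (C \ (F' ∪ A)).ncard := by
    intro F hF
    obtain ⟨hG, hGc, hGr⟩ := hψ F hF
    have h1 := hG.rk_lt_ncard
    have h2 := hG.rk_lt_rk_ground
    obtain ⟨F', hF', h3, h4⟩ := hG.exists_of_liftRk_eq hA hC hAE hUE hAU hCN
      (hE ▸ subset_union_left) hle (by lia)
      (((hmin _ hG.1.subset_ground).resolve_left h1.ne).resolve_left (by lia))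
    exact ⟨F', hF', h3, by lia⟩
  choose! σ hσ hσψ hσr using key
  set Z := hfinZ.toFinset with hZ
  have hmem : ∀ F, F ∈ Z ↔ P.IsNonemptyProperCyclicFlat F := by simp [hZ]
  have hinj : Set.InjOn σ Z := by
    intro F hF F' hF' hFF
    rw [Finset.mem_coe, hmem] at hF hF'
    refine hψinj F F' hF.1.subset_ground hF'.1.subset_ground ?_
    rw [hσψ F hF, hσψ F' hF', hFF]
  classical
  -- An injective self-map of a finite set is a permutation, so sums over `Z` are invariant under
  -- `σ`.
  have himg : Z.image σ = Z := by
    refine Finset.eq_of_subset_of_card_le ?_ (Finset.card_image_of_injOn hinj).ge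
    intro F hF
    obtain ⟨F', hF', rfl⟩ := Finset.mem_image.1 hF
    rw [hmem] at hF' ⊢
    exact hσ F' hF'
  have hsum : ∀ f : Set α → ℕ, ∑ F ∈ Z, f (σ F) = ∑ F ∈ Z, f F := fun f ↦ by
    conv_rhs => rw [← himg, Finset.sum_image hinj]
  have hCsub : ∀ F, P.IsNonemptyProperCyclicFlat F → C ⊆ F ∪ A := by
    -- Each rank identity `hσr` carries a nonnegative defect; summing over the permutation shows
    -- that all defects vanish.
    have h1 : ∑ F ∈ Z, P.rk F = ∑ F ∈ Z, P.rk F + ∑ F ∈ Z, (C \ (F ∪ A)).ncard := by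
      rw [← hsum (fun F ↦ P.rk F), ← hsum (fun F ↦ (C \ (F ∪ A)).ncard),
        ← Finset.sum_add_distrib, hsum]
      exact Finset.sum_congr rfl fun F hF ↦ hσr F ((hmem F).1 hF)
    have h2 : ∑ F ∈ Z, (C \ (F ∪ A)).ncard = 0 := by lia
    intro F hF
    have := (Finset.sum_eq_zero_iff.1 h2) F ((hmem F).2 hF)
    rwa [ncard_eq_zero (hC.subset sdiff_subset), sdiff_eq_empty] at this
  refine ⟨hCsub F hF, ?_⟩
  have hcard : ∀ F, P.IsNonemptyProperCyclicFlat F →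
      F.ncard = ((F ∪ A) ∩ N.E).ncard + ((F ∪ A) ∩ D).ncard := by
    intro F hF
    have hFf := hPf.subset hF.1.subset_ground
    have hFAf := hFf.union hA
    have h1 : F ∪ A = ((F ∪ A) ∩ N.E ∪ (F ∪ A) ∩ D) ∪ C := by
      refine subset_antisymm (fun x hx ↦ ?_) (union_subset (union_subset inter_subset_left
        inter_subset_left) (hCsub F hF))
      have : x ∈ N.E ∪ C ∪ D := by
        rw [hE]
        exact .inl (union_subset_union_left A hF.1.subset_ground hx)
      simp only [mem_union, mem_inter_iff] at this hx ⊢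
      tauto
    have h2 := congrArg ncard h1
    rw [ncard_union_eq (hAE.symm.mono_left hF.1.subset_ground) hFf hA,
      ncard_union_eq (disjoint_union_left.2 ⟨hCN.symm.mono_left inter_subset_right,
        hCD.symm.mono_left inter_subset_right⟩) ((hFAf.subset inter_subset_left).union
        (hFAf.subset inter_subset_left)) hC,
      ncard_union_eq (hDN.symm.mono inter_subset_right inter_subset_right)
        (hFAf.subset inter_subset_left) (hFAf.subset inter_subset_left)] at h2
    lia
  -- The same argument with sizes: the isomorphism preserves the size of each flat, and the defect
  -- is now the part of `F ∪ A` lost to deletion.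
  have h1 : ∑ F ∈ Z, F.ncard = ∑ F ∈ Z, F.ncard + ∑ F ∈ Z, ((F ∪ A) ∩ D).ncard := by
    have h3 : ∑ F ∈ Z, F.ncard = ∑ F ∈ Z, ((F ∪ A) ∩ N.E).ncard := by
      rw [← hsum (fun F ↦ ((F ∪ A) ∩ N.E).ncard)]
      refine Finset.sum_congr rfl fun F hF ↦ ?_
      rw [hmem] at hF
      rw [← hσψ F hF, (hψ F hF).2.1]
    conv_rhs => rw [h3, ← Finset.sum_add_distrib]
    exact Finset.sum_congr rfl fun F hF ↦ hcard F ((hmem F).1 hF)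
  have h2 : ∑ F ∈ Z, ((F ∪ A) ∩ D).ncard = 0 := by lia
  have h3 := (Finset.sum_eq_zero_iff.1 h2) F ((hmem F).2 hF)
  rw [ncard_eq_zero (((hPf.subset hF.1.subset_ground).union hA).subset inter_subset_left)] at h3
  exact (disjoint_iff_inter_eq_empty.2 h3).symm

end Counting

/-! ### Pairs of lifts and the minimum of their rank functions -/

/-- Two finite matroids `M₁` and `M₂` on disjoint sets, with a common set in which the ground set of
`Mᵢ` is complemented by the sets `Aᵢ` and `Uᵢ`, so that the free coextension of `Mᵢ` by `Aᵢ` has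
rank `k`, a number that is large compared to the sizes of `M₁` and `M₂`. -/
structure IsLiftPair {α : Type u} (M₁ : Matroid α) (A₁ U₁ : Set α) (M₂ : Matroid α) (A₂ U₂ : Set α)
    (k : ℕ) : Prop where
  finite₁ : M₁.Finite
  finite₂ : M₂.Finite
  finite_A₁ : A₁.Finite
  finite_U₁ : U₁.Finite
  finite_A₂ : A₂.Finite
  finite_U₂ : U₂.Finite
  nonempty₁ : M₁.E.Nonempty
  nonempty₂ : M₂.E.Nonempty
  disj_A₁ : Disjoint A₁ M₁.E
  disj_U₁ : Disjoint U₁ M₁.E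
  disj_AU₁ : Disjoint A₁ U₁
  disj_A₂ : Disjoint A₂ M₂.E
  disj_U₂ : Disjoint U₂ M₂.E
  disj_AU₂ : Disjoint A₂ U₂
  disj_ground : Disjoint M₁.E M₂.E
  disj_A : Disjoint A₁ A₂
  disj_U : Disjoint U₁ U₂
  ground_eq : M₁.E ∪ A₁ ∪ U₁ = M₂.E ∪ A₂ ∪ U₂
  rank₁ : M₁.rk M₁.E + A₁.ncard = k
  rank₂ : M₂.rk M₂.E + A₂.ncard = k
  large₁ : 4 * M₁.E.ncard ≤ k
  large₂ : 4 * M₂.E.ncard ≤ k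

/-- `M` is the matroid whose rank function is the minimum of the rank functions of the lifts of
`M₁` and `M₂`. -/
structure IsLiftMeet {α : Type u} (M M₁ : Matroid α) (A₁ U₁ : Set α) (M₂ : Matroid α)
    (A₂ U₂ : Set α) (k : ℕ) : Prop where
  ground_eq : M.E = M₁.E ∪ A₁ ∪ U₁
  rk_eq : ∀ X ⊆ M.E,
    M.rk X = min (min X.ncard k) (min (M₁.liftRk A₁ U₁ X) (M₂.liftRk A₂ U₂ X))

section LiftPair

variable {α : Type u} {M M₁ M₂ : Matroid α} {A₁ U₁ A₂ U₂ F G C D X : Set α} {k : ℕ}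

/-- The criterion for the `M₂` term to be vacuous on all supersets of `C`, since ranks are capped at
`k`. -/
lemma le_liftRk [M₂.RankFinite] (hr : M₂.rk M₂.E + A₂.ncard = k) (hX : X.Finite) (hCX : C ⊆ X)
    (hC : M₂.rk M₂.E ≤ M₂.rk C + (C ∩ U₂).ncard) : k ≤ M₂.liftRk A₂ U₂ X := by
  have h1 := M₂.rk_mono hCX
  have h2 := ncard_le_ncard (inter_subset_inter_left U₂ hCX) (hX.subset inter_subset_left)
  rw [liftRk]
  lia

namespace IsLiftPair

lemma symm (h : IsLiftPair M₁ A₁ U₁ M₂ A₂ U₂ k) : IsLiftPair M₂ A₂ U₂ M₁ A₁ U₁ k where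
  finite₁ := h.finite₂
  finite₂ := h.finite₁
  finite_A₁ := h.finite_A₂
  finite_U₁ := h.finite_U₂
  finite_A₂ := h.finite_A₁
  finite_U₂ := h.finite_U₁
  nonempty₁ := h.nonempty₂
  nonempty₂ := h.nonempty₁
  disj_A₁ := h.disj_A₂
  disj_U₁ := h.disj_U₂
  disj_AU₁ := h.disj_AU₂
  disj_A₂ := h.disj_A₁
  disj_U₂ := h.disj_U₁
  disj_AU₂ := h.disj_AU₁
  disj_ground := h.disj_ground.symm
  disj_A := h.disj_A.symm
  disj_U := h.disj_U.symm
  ground_eq := h.ground_eq.symm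
  rank₁ := h.rank₂
  rank₂ := h.rank₁
  large₁ := h.large₂
  large₂ := h.large₁

lemma ground_finite (h : IsLiftPair M₁ A₁ U₁ M₂ A₂ U₂ k) : (M₁.E ∪ A₁ ∪ U₁).Finite :=
  (h.finite₁.ground_finite.union h.finite_A₁).union h.finite_U₁

lemma ground_subset (h : IsLiftPair M₁ A₁ U₁ M₂ A₂ U₂ k) :
    M₁.E ∪ A₁ ∪ U₁ ⊆ M₁.E ∪ M₂.E ∪ (U₁ ∪ U₂) := by
  intro x hx
  have hx' := hx
  rw [h.ground_eq] at hx'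
  have h3 : x ∈ A₁ → x ∉ A₂ := fun hx ↦ disjoint_left.1 h.disj_A hx
  simp only [mem_union] at hx hx' ⊢
  tauto

lemma ncard_ground_pos₁ (h : IsLiftPair M₁ A₁ U₁ M₂ A₂ U₂ k) : 0 < M₁.E.ncard :=
  (ncard_pos h.finite₁.ground_finite).2 h.nonempty₁

/-- As `A₁` misses `A₂`, only elements of `M₂.E` can be in `A₁` but not in `U₂`, and `|A₁| = k -
r(M₁)` is large. Hence `A₁` alone pushes the `M₂` term to `k + 1`; the extra 1 allows one element to
be removed. -/
lemma rk_lt_ncard_inter (h : IsLiftPair M₁ A₁ U₁ M₂ A₂ U₂ k) :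
    M₂.rk M₂.E + 1 ≤ (A₁ ∩ U₂).ncard := by
  have := h.finite₁
  have := h.finite₂
  have h1 := M₁.rk_le_ncard M₁.ground_finite
  have h2 := M₂.rk_le_ncard M₂.ground_finite
  have h3 := ncard_inter_add_ncard_sdiff_eq_ncard A₁ U₂ h.finite_A₁
  have h4 : A₁ \ U₂ ⊆ M₂.E := by
    rintro x ⟨hx, hxU⟩
    have hx' : x ∈ M₂.E ∪ A₂ ∪ U₂ := h.ground_eq ▸ .inl (.inr hx)
    have := disjoint_left.1 h.disj_A hx
    simp only [mem_union] at hx'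
    tauto
  have h5 := ncard_le_ncard h4 M₂.ground_finite
  have h6 := h.rank₁
  have h7 := h.large₁
  have h8 := h.large₂
  have h9 := h.ncard_ground_pos₁
  lia

/-- A minimum of two submodular functions need not be submodular. If both minima come from the same
matroid, its own submodularity suffices. In the mixed case, `|X ∩ Y|` and `k` bound the ranks of the
intersection and the union, and `cross` compares their sum with the two terms. -/
lemma exists_isLiftMeet (h : IsLiftPair M₁ A₁ U₁ M₂ A₂ U₂ k) :
    ∃ M : Matroid α, M.IsLiftMeet M₁ A₁ U₁ M₂ A₂ U₂ k := by
  have := h.finite₁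
  have := h.finite₂
  have hE := h.ground_finite
  obtain ⟨N₁, -, hN₁, hE₁, hr₁⟩ :=
    M₁.exists_yields_lift h.finite_A₁ h.finite_U₁ h.disj_A₁ h.disj_U₁ h.disj_AU₁
  obtain ⟨N₂, -, hN₂, hE₂, hr₂⟩ :=
    M₂.exists_yields_lift h.finite_A₂ h.finite_U₂ h.disj_A₂ h.disj_U₂ h.disj_AU₂
  rw [hE₁, h.rank₁] at hr₁
  rw [hE₂, h.rank₂, ← h.ground_eq] at hr₂
  obtain ⟨M, hME, hr⟩ := exists_rk_eq hE (fun X ↦ min (N₁.rk X) (N₂.rk X))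
    (fun X hX ↦ min_le_of_left_le (N₁.rk_le_ncard (hE.subset hX)))
    (fun X Y hXY _ ↦ min_le_min (N₁.rk_mono hXY) (N₂.rk_mono hXY))
    (fun X Y hX hY ↦ by
      have hXf := hE.subset hX
      have hYf := hE.subset hY
      have hI := N₁.rk_le_ncard (hXf.subset (inter_subset_left (t := Y)))
      have hU : N₁.rk (X ∪ Y) ≤ k := by
        rw [hr₁ (X ∪ Y) (union_subset hX hY)]
        exact (min_le_right _ _).trans (min_le_right _ _)
      have hX₁ := hr₁ X hX
      have hX₂ := hr₂ X hX
      have hY₁ := hr₁ Y hY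
      have hY₂ := hr₂ Y hY
      have hs₁ := N₁.rk_submod X Y
      have hs₂ := N₂.rk_submod X Y
      have hr1 := M₁.rk_le_ncard M₁.ground_finite
      have hr2 := M₂.rk_le_ncard M₂.ground_finite
      have hk₁ := h.rank₁
      have hk₂ := h.rank₂
      have hl₁ := h.large₁
      have hl₂ := h.large₂
      -- Since `|A₁| + |A₂| = 2k - r(M₁) - r(M₂)`, this needs only `|S₁| + |S₂| + r(M₁) + r(M₂) ≤
      -- k`, which is where the factor 4 enters.
      have cross : ∀ X Y : Set α, X.Finite → Y.Finite → X ⊆ M₁.E ∪ A₁ ∪ U₁ →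
          k + (X ∩ Y).ncard ≤ M₁.liftRk A₁ U₁ X + M₂.liftRk A₂ U₂ Y := by
        intro X Y hXf hYf hX
        have h1 : X ∩ Y ⊆ M₁.E ∪ M₂.E ∪ ((X ∩ U₁) ∪ (Y ∩ U₂)) := by
          rintro x ⟨hxX, hxY⟩
          have := h.ground_subset (hX hxX)
          simp only [mem_union, mem_inter_iff] at this ⊢
          tauto
        have h2 := ncard_le_ncard h1 ((M₁.ground_finite.union M₂.ground_finite).union
          ((hXf.subset inter_subset_left).union (hYf.subset inter_subset_left)))
        have h3 := ncard_union_le (M₁.E ∪ M₂.E) ((X ∩ U₁) ∪ (Y ∩ U₂))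
        have h4 := ncard_union_le M₁.E M₂.E
        have h5 := ncard_union_le (X ∩ U₁) (Y ∩ U₂)
        rw [liftRk, liftRk]
        lia
      have hc₁ := cross X Y hXf hYf hX
      have hc₂ := cross Y X hYf hXf hY
      rw [inter_comm] at hc₂
      omega)
  refine ⟨M, hME, fun X hX ↦ ?_⟩
  rw [hME] at hX
  rw [hr X hX, hr₁ X hX, hr₂ X hX]
  lia

end IsLiftPair

/-! ### The minimum matroid: cyclic flats, obvious minors, all minors isomorphic to `M₁` -/

namespace IsLiftMeet

lemma symm (h : IsLiftPair M₁ A₁ U₁ M₂ A₂ U₂ k) (hM : M.IsLiftMeet M₁ A₁ U₁ M₂ A₂ U₂ k) :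
    M.IsLiftMeet M₂ A₂ U₂ M₁ A₁ U₁ k where
  ground_eq := hM.ground_eq.trans h.ground_eq
  rk_eq X hX := by rw [hM.rk_eq X hX, min_comm (M₁.liftRk A₁ U₁ X)]

lemma finite (h : IsLiftPair M₁ A₁ U₁ M₂ A₂ U₂ k) (hM : M.IsLiftMeet M₁ A₁ U₁ M₂ A₂ U₂ k) :
    M.Finite := ⟨hM.ground_eq ▸ h.ground_finite⟩

/-- This gives both the rank `k` of `M` and the absence of coloops, so that the ground set is a
cyclic flat. -/
lemma le_rk_sdiff_singleton (h : IsLiftPair M₁ A₁ U₁ M₂ A₂ U₂ k)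
    (hM : M.IsLiftMeet M₁ A₁ U₁ M₂ A₂ U₂ k) (e : α) : k ≤ M.rk (M.E \ {e}) := by
  have aux : ∀ {M₁ M₂ : Matroid α} {A₁ U₁ A₂ U₂ : Set α}, IsLiftPair M₁ A₁ U₁ M₂ A₂ U₂ k →
      k ≤ M₁.liftRk A₁ U₁ ((M₁.E ∪ A₁ ∪ U₁) \ {e}) := by
    intro M₁ M₂ A₁ U₁ A₂ U₂ h
    have := h.finite₁
    have h1 : M₁.rk M₁.E ≤ M₁.rk ((M₁.E ∪ A₁ ∪ U₁) \ {e}) + 1 := by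
      refine (M₁.rk_mono ?_).trans (M₁.rk_insert_le e _)
      intro x hx
      simp only [mem_insert_iff, mem_sdiff, mem_union, mem_singleton_iff]
      tauto
    have hp := h.ncard_ground_pos₁
    have h2 := h.symm.rk_lt_ncard_inter
    have h3 := ncard_le_ncard (inter_subset_right (s := A₂) (t := U₁)) h.finite_U₁
    have h4 := h.rank₁
    by_cases heE : e ∈ M₁.E
    · have h5 : ((M₁.E ∪ A₁ ∪ U₁) \ {e}) ∩ U₁ = U₁ := by
        refine inter_eq_self_of_subset_right fun x hx ↦ ⟨.inr hx, ?_⟩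
        rintro rfl
        exact disjoint_left.1 h.disj_U₁ hx heE
      rw [liftRk, h5]
      lia
    · have h5 : M₁.rk ((M₁.E ∪ A₁ ∪ U₁) \ {e}) = M₁.rk M₁.E := by
        refine M₁.rk_congr_inter ?_
        rw [inter_self, inter_eq_right]
        refine fun x hx ↦ ⟨.inl (.inl hx), ?_⟩
        rintro rfl; exact heE hx
      rw [liftRk, h5]
      lia
  have := hM.finite h
  have hf₁ := h.finite₁
  have h1 := aux h
  have h2 := aux h.symm
  rw [← hM.ground_eq] at h1
  rw [← h.ground_eq, ← hM.ground_eq] at h2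
  have h3 : k + 1 ≤ M.E.ncard := by
    have h4 : (A₂ ∪ (A₁ ∩ U₂)).ncard ≤ M.E.ncard := by
      refine ncard_le_ncard (union_subset ?_ ?_) M.ground_finite
      · rw [hM.ground_eq, h.ground_eq]
        exact fun x hx ↦ .inl (.inr hx)
      · rw [hM.ground_eq]
        exact fun x hx ↦ .inl (.inr hx.1)
    rw [ncard_union_eq (h.disj_A.symm.mono_right inter_subset_left) h.finite_A₂
      (h.finite_A₁.subset inter_subset_left)] at h4
    have h5 := h.rk_lt_ncard_inter
    have h6 := h.rank₂
    lia
  have h4 : M.E.ncard ≤ (M.E \ {e}).ncard + 1 := by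
    by_cases he : e ∈ M.E
    · rw [ncard_sdiff_singleton_add_one he M.ground_finite]
    · rw [sdiff_singleton_eq_self he]; lia
  rw [hM.rk_eq _ sdiff_subset]
  lia

lemma rk_ground (h : IsLiftPair M₁ A₁ U₁ M₂ A₂ U₂ k) (hM : M.IsLiftMeet M₁ A₁ U₁ M₂ A₂ U₂ k) :
    M.rk M.E = k := by
  have := hM.finite h
  obtain ⟨e, he⟩ := h.nonempty₁
  have h1 := hM.le_rk_sdiff_singleton h e
  have h2 := M.rk_mono (sdiff_subset (s := M.E) (t := {e}))
  have h3 := hM.rk_eq M.E Subset.rfl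
  lia

lemma isCyclicFlat_ground (h : IsLiftPair M₁ A₁ U₁ M₂ A₂ U₂ k)
    (hM : M.IsLiftMeet M₁ A₁ U₁ M₂ A₂ U₂ k) : M.IsCyclicFlat M.E := by
  have := hM.finite h
  refine isCyclicFlat_iff_rk.2 ⟨Subset.rfl, by simp, fun e _ ↦ ?_⟩
  have h1 := hM.le_rk_sdiff_singleton h e
  have h2 := M.rk_mono (sdiff_subset (s := M.E) (t := {e}))
  have h3 := hM.rk_ground h
  lia

lemma isCyclicFlat_empty (h : IsLiftPair M₁ A₁ U₁ M₂ A₂ U₂ k)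
    (hM : M.IsLiftMeet M₁ A₁ U₁ M₂ A₂ U₂ k) : M.IsCyclicFlat ∅ := by
  have := hM.finite h
  refine isCyclicFlat_iff_rk.2 ⟨empty_subset _, ?_, by simp⟩
  rintro e ⟨he, -⟩
  have := h.finite₁
  have := h.finite₂
  have h1 := M₁.rk_le_ncard M₁.ground_finite
  have h2 := M₂.rk_le_ncard M₂.ground_finite
  have h3 := h.rank₁
  have h4 := h.rank₂
  have h5 := h.large₁
  have h6 := h.large₂
  have h7 := h.ncard_ground_pos₁
  have h8 := h.symm.ncard_ground_pos₁
  rw [insert_empty_eq, rk_empty, hM.rk_eq _ (singleton_subset_iff.2 he), ncard_singleton, liftRk,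
    liftRk]
  lia

/-- Around `F ∪ A₁`, even after removing one element, the `M₂` term is at least `k`; so only the
`M₁` term matters, and both rank conditions follow from those for `F` in `M₁`. -/
lemma union_isCyclicFlat (h : IsLiftPair M₁ A₁ U₁ M₂ A₂ U₂ k)
    (hM : M.IsLiftMeet M₁ A₁ U₁ M₂ A₂ U₂ k) (hF : M₁.IsNonemptyProperCyclicFlat F) :
    M.IsCyclicFlat (F ∪ A₁) ∧ M.rk (F ∪ A₁) = M₁.rk F + A₁.ncard := by
  have hfin := hM.finite h
  have := h.finite₁
  have := h.finite₂
  have hFE := hF.1.subset_ground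
  have hFf := M₁.ground_finite.subset hFE
  have hFAf := hFf.union h.finite_A₁
  have hFA : Disjoint F A₁ := h.disj_A₁.symm.mono_left hFE
  have hsub : F ∪ A₁ ⊆ M.E := by
    rw [hM.ground_eq]
    exact (union_subset_union_left A₁ hFE).trans subset_union_left
  have hcard : (F ∪ A₁).ncard = F.ncard + A₁.ncard := ncard_union_eq hFA hFf h.finite_A₁
  have hinter : (F ∪ A₁) ∩ M₁.E = F := by
    rw [union_inter_distrib_right, h.disj_A₁.inter_eq, union_empty, inter_eq_left.2 hFE]
  have hU : (F ∪ A₁) ∩ U₁ = ∅ := by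
    rw [← disjoint_iff_inter_eq_empty, disjoint_union_left]
    exact ⟨h.disj_U₁.symm.mono_left hFE, h.disj_AU₁⟩
  have hlift : M₁.liftRk A₁ U₁ (F ∪ A₁) = M₁.rk F + A₁.ncard := by
    rw [liftRk, hU, ← M₁.rk_inter_ground, hinter, ncard_empty, add_zero]
  have hlarge := h.rk_lt_ncard_inter
  have hinterU : (A₁ ∩ U₂).ncard ≤ ((F ∪ A₁) ∩ U₂).ncard :=
    ncard_le_ncard (inter_subset_inter_left _ subset_union_right) (hFAf.subset inter_subset_left)
  have hk₁ := h.rank₁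
  have hk₂ := h.rank₂
  have hlift₂ : k + 1 ≤ M₂.liftRk A₂ U₂ (F ∪ A₁) := by
    rw [liftRk]; lia
  have hlt := hF.rk_lt_ncard
  have hlt' := hF.rk_lt_rk_ground
  have hrk : M.rk (F ∪ A₁) = M₁.rk F + A₁.ncard := by
    rw [hM.rk_eq _ hsub]
    lia
  obtain ⟨-, hflat, hcyc⟩ := isCyclicFlat_iff_rk.1 hF.1
  refine ⟨isCyclicFlat_iff_rk.2 ⟨hsub, fun e he ↦ ?_, fun e he ↦ ?_⟩, hrk⟩
  · have h1 : M₁.liftRk A₁ U₁ (F ∪ A₁) + 1 ≤ M₁.liftRk A₁ U₁ (insert e (F ∪ A₁)) := by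
      rw [hlift]
      by_cases heU : e ∈ U₁
      · have h2 : 1 ≤ (insert e (F ∪ A₁) ∩ U₁).ncard := by
          rw [Nat.one_le_iff_ne_zero, ← pos_iff_ne_zero,
            ncard_pos ((hFAf.insert e).subset inter_subset_left)]
          exact ⟨e, mem_insert _ _, heU⟩
        have h3 : M₁.rk F ≤ M₁.rk (insert e (F ∪ A₁)) :=
          M₁.rk_mono (subset_union_left.trans (subset_insert _ _))
        rw [liftRk]
        lia
      · have heE : e ∈ M₁.E := by
          have := he.1
          rw [hM.ground_eq] at this
          have := he.2
          simp only [mem_union] at *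
          tauto
        have h2 := hflat e ⟨heE, fun h ↦ he.2 (.inl h)⟩
        have h3 : M₁.rk (insert e F) ≤ M₁.rk (insert e (F ∪ A₁)) :=
          M₁.rk_mono (insert_subset_insert subset_union_left)
        rw [liftRk]
        lia
    have h2 : M₂.liftRk A₂ U₂ (F ∪ A₁) ≤ M₂.liftRk A₂ U₂ (insert e (F ∪ A₁)) := by
      have := M₂.rk_mono (subset_insert e (F ∪ A₁))
      have := ncard_le_ncard (inter_subset_inter_left U₂ (subset_insert e (F ∪ A₁)))
        ((hFAf.insert e).subset inter_subset_left)
      rw [liftRk, liftRk]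
      lia
    have h3 := ncard_insert_of_notMem he.2 hFAf
    rw [hrk, hM.rk_eq _ (insert_subset he.1 hsub)]
    lia
  · have h1 : M₁.liftRk A₁ U₁ ((F ∪ A₁) \ {e}) = M₁.rk F + A₁.ncard := by
      have h2 : ((F ∪ A₁) \ {e}) ∩ U₁ = ∅ :=
        subset_empty_iff.1 (hU ▸ inter_subset_inter_left _ sdiff_subset)
      have h3 : M₁.rk ((F ∪ A₁) \ {e}) = M₁.rk F := by
        rw [← rk_inter_ground, ← inter_sdiff_right_comm, hinter]
        by_cases heF : e ∈ F
        · exact hcyc e heF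
        · rw [sdiff_singleton_eq_self heF]
      rw [liftRk, h2, h3, ncard_empty, add_zero]
    have h2 : k ≤ M₂.liftRk A₂ U₂ ((F ∪ A₁) \ {e}) := by
      have h3 : (F ∪ A₁) ∩ U₂ ⊆ insert e (((F ∪ A₁) \ {e}) ∩ U₂) := by
        intro x
        simp only [mem_inter_iff, mem_insert_iff, mem_sdiff, mem_singleton_iff]
        tauto
      have h4 := (ncard_le_ncard h3 (((hFAf.subset sdiff_subset).subset
        inter_subset_left).insert e)).trans (ncard_insert_le _ _)
      rw [liftRk]
      lia
    have h3 := ncard_sdiff_singleton_add_one he hFAf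
    rw [hrk, hM.rk_eq _ (sdiff_subset.trans hsub)]
    lia

lemma isCyclicFlat_iff (h : IsLiftPair M₁ A₁ U₁ M₂ A₂ U₂ k)
    (hM : M.IsLiftMeet M₁ A₁ U₁ M₂ A₂ U₂ k) : M.IsCyclicFlat G ↔ G = ∅ ∨ G = M.E ∨
      (∃ F, M₁.IsNonemptyProperCyclicFlat F ∧ G = F ∪ A₁) ∨
      ∃ F, M₂.IsNonemptyProperCyclicFlat F ∧ G = F ∪ A₂ := by
  have hfin := hM.finite h
  have := h.finite₁
  have := h.finite₂
  constructor
  · intro hG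
    by_contra! hcon
    obtain ⟨hne, hnE, hn₁, hn₂⟩ := hcon
    have hG' : M.IsNonemptyProperCyclicFlat G := ⟨hG, hne, hnE⟩
    have aux : ∀ {M₁ M₂ : Matroid α} {A₁ U₁ A₂ U₂ : Set α}, IsLiftPair M₁ A₁ U₁ M₂ A₂ U₂ k →
        M.IsLiftMeet M₁ A₁ U₁ M₂ A₂ U₂ k → M.rk G = M₁.liftRk A₁ U₁ G →
        ∃ F, M₁.IsNonemptyProperCyclicFlat F ∧ G = F ∪ A₁ := by
      intro M₁ M₂ A₁ U₁ A₂ U₂ h hM hr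
      have := h.finite₁
      obtain ⟨F, hF, hGF, -⟩ := hG'.exists_of_liftRk_eq (P := M₁) (A := A₁) (U := U₁) (C := ∅)
        h.finite_A₁ finite_empty h.disj_A₁ h.disj_U₁ h.disj_AU₁ (empty_disjoint _)
        (by rw [union_empty, hM.ground_eq])
        (fun Y hY ↦ by
          rw [ncard_empty, add_zero, union_empty, hM.rk_eq Y hY]
          lia)
        (by rw [hM.rk_ground h, h.rank₁, ncard_empty, add_zero])
        (by rwa [ncard_empty, add_zero, union_empty])
      refine ⟨F, hF, ?_⟩
      rw [hGF, inter_eq_left, hM.ground_eq]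
      exact (union_subset_union_left _ hF.1.subset_ground).trans subset_union_left
    have h1 := hM.rk_eq G hG.subset_ground
    have h2 := hG'.rk_lt_ncard
    have h3 := hG'.rk_lt_rk_ground
    rw [hM.rk_ground h] at h3
    -- A nonempty proper cyclic flat is neither independent nor spanning, which excludes the values
    -- `|G|` and `k` in the minimum.
    obtain h4 | h4 : M.rk G = M₁.liftRk A₁ U₁ G ∨ M.rk G = M₂.liftRk A₂ U₂ G := by lia
    · obtain ⟨F, hF, hGF⟩ := aux h hM h4
      exact hn₁ F hF hGF
    · obtain ⟨F, hF, hGF⟩ := aux h.symm (hM.symm h) h4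
      exact hn₂ F hF hGF
  · rintro (rfl | rfl | ⟨F, hF, rfl⟩ | ⟨F, hF, rfl⟩)
    · exact hM.isCyclicFlat_empty h
    · exact hM.isCyclicFlat_ground h
    · exact (hM.union_isCyclicFlat h hF).1
    · exact ((hM.symm h).union_isCyclicFlat h.symm hF).1

/-- Contracting `A₁` saturates the `M₂` term, and on sets `X ∪ A₁` with `X ⊆ M₁.E` the `M₁` term is
`r₁(X) + |A₁|`. -/
lemma contract_delete_eq (h : IsLiftPair M₁ A₁ U₁ M₂ A₂ U₂ k)
    (hM : M.IsLiftMeet M₁ A₁ U₁ M₂ A₂ U₂ k) : M ／ A₁ ＼ U₁ = M₁ := by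
  have hfin := hM.finite h
  have := h.finite₁
  have := h.finite₂
  have hk₁ := h.rank₁
  have hAE : A₁ ⊆ M.E := hM.ground_eq ▸ fun x hx ↦ .inl (.inr hx)
  have hrk : ∀ X ⊆ M₁.E, M.rk (X ∪ A₁) = M₁.rk X + A₁.ncard := by
    intro X hX
    have hXf := M₁.ground_finite.subset hX
    have h1 : X ∪ A₁ ⊆ M.E := by
      rw [hM.ground_eq]; exact (union_subset_union_left _ hX).trans subset_union_left
    have h2 := ncard_union_eq (h.disj_A₁.symm.mono_left hX) hXf h.finite_A₁
    have h3 : k ≤ M₂.liftRk A₂ U₂ (X ∪ A₁) :=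
      le_liftRk h.rank₂ (hXf.union h.finite_A₁) subset_union_right
        (by have := h.rk_lt_ncard_inter; lia)
    have h4 : (X ∪ A₁) ∩ U₁ = ∅ := by
      rw [← disjoint_iff_inter_eq_empty, disjoint_union_left]
      exact ⟨h.disj_U₁.symm.mono_left hX, h.disj_AU₁⟩
    have h5 : (X ∪ A₁) ∩ M₁.E = X := by
      rw [union_inter_distrib_right, h.disj_A₁.inter_eq, union_empty, inter_eq_left.2 hX]
    have h6 : M₁.liftRk A₁ U₁ (X ∪ A₁) = M₁.rk X + A₁.ncard := by
      rw [liftRk, h4, ← M₁.rk_inter_ground, h5, ncard_empty, add_zero]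
    have h7 := M₁.rk_le_ncard hXf
    have h8 := M₁.rk_le_rk_ground X
    rw [hM.rk_eq _ h1]
    lia
  have hAi : M.Indep A₁ := by
    rw [indep_iff_rk h.finite_A₁]
    simpa using hrk ∅ (empty_subset _)
  have hE : (M ／ A₁ ＼ U₁).E = M₁.E := by
    rw [delete_ground, contract_ground, hM.ground_eq]
    ext x
    have h1 : x ∈ A₁ → x ∉ M₁.E := fun hx ↦ disjoint_left.1 h.disj_A₁ hx
    have h2 : x ∈ U₁ → x ∉ M₁.E := fun hx ↦ disjoint_left.1 h.disj_U₁ hx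
    simp only [mem_sdiff, mem_union]
    tauto
  have : (M ／ A₁ ＼ U₁).Finite := ⟨hE ▸ M₁.ground_finite⟩
  refine ext_rk hE fun X hX ↦ ?_
  have h1 := rk_contract_delete hAi hX
  rw [hrk X (hE ▸ hX)] at h1
  lia

/-- Any minor of `M` isomorphic to `M₁` is close to the obvious one. -/
lemma subset_and_disjoint_of_minor (h : IsLiftPair M₁ A₁ U₁ M₂ A₂ U₂ k)
    (hM : M.IsLiftMeet M₁ A₁ U₁ M₂ A₂ U₂ k) (hy : ¬ M₂.Yields M₁) (hC : M.Indep C)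
    (hD : M.Coindep D) (hCD : Disjoint C D) (hiso : (M ／ C ＼ D).IsIsomorphic M₁)
    (hF : M₁.IsNonemptyProperCyclicFlat F) : C ⊆ F ∪ A₁ ∧ Disjoint D (F ∪ A₁) := by
  have hfin := hM.finite h
  have := h.finite₁
  have := h.finite₂
  have hNE : (M ／ C ＼ D).E = (M.E \ C) \ D := rfl
  have hNfin : (M ／ C ＼ D).Finite := ⟨M.ground_finite.subset (sdiff_subset.trans sdiff_subset)⟩
  have hCE := hC.subset_ground
  have hDE : D ⊆ M.E := hD.subset_ground
  have hCf := M.ground_finite.subset hCE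
  have hk₁ := h.rank₁
  have hk₂ := h.rank₂
  have hrk : ∀ Y ⊆ (M ／ C ＼ D).E, (M ／ C ＼ D).rk Y + C.ncard = M.rk (Y ∪ C) :=
    fun Y hY ↦ rk_contract_delete hC hY
  have hYE : ∀ Y ⊆ (M ／ C ＼ D).E, Y ∪ C ⊆ M.E := fun Y hY ↦
    union_subset (hY.trans (sdiff_subset.trans sdiff_subset)) hCE
  have hCN : Disjoint C (M ／ C ＼ D).E := disjoint_sdiff_right.mono_right sdiff_subset
  have hcard : ∀ Y ⊆ (M ／ C ＼ D).E, (Y ∪ C).ncard = Y.ncard + C.ncard := fun Y hY ↦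
    ncard_union_eq (hCN.symm.mono_left hY) (hNfin.ground_finite.subset hY) hCf
  -- Deleting a coindependent set keeps the rank `k`, so contracting `C` must account for all of `k
  -- - r(M₁)`.
  have hCA : C.ncard = A₁.ncard := by
    have h1 := hrk _ Subset.rfl
    have h2 : (M ／ C ＼ D).E ∪ C = M.E \ D := by
      rw [hNE]
      ext x
      have h1 : x ∈ C → x ∈ M.E := fun hx ↦ hCE hx
      have h2 : x ∈ C → x ∉ D := fun hx ↦ disjoint_left.1 hCD hx
      simp only [mem_sdiff, mem_union]
      tauto
    have h3 : M.rk (M.E \ D) = k := by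
      rw [← hM.rk_ground h, rk, rk, hD.compl_spanning.eRk_eq, eRk_ground]
    rw [h2, h3, hiso.rk_ground_eq] at h1
    lia
  by_cases hcase₂ : M₂.rk M₂.E ≤ M₂.rk C + (C ∩ U₂).ncard
  · have hform : ∀ Y ⊆ (M ／ C ＼ D).E, (M ／ C ＼ D).rk Y + C.ncard =
        min (min (Y.ncard + C.ncard) k) (M₁.liftRk A₁ U₁ (Y ∪ C)) := by
      intro Y hY
      have := le_liftRk (A₂ := A₂) hk₂ (M.ground_finite.subset (hYE Y hY)) subset_union_right hcase₂
      rw [hrk Y hY, hM.rk_eq _ (hYE Y hY), hcard Y hY]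
      lia
    refine subset_and_disjoint_of_isIsomorphic_lift_minor h.finite_A₁ hCf h.disj_A₁ h.disj_U₁
      h.disj_AU₁ hCN disjoint_sdiff_right hCD ?_ hCA (fun Y hY ↦ ?_) (fun Y hY ↦ ?_) hiso hF
    · rw [← hM.ground_eq, hNE]
      ext x
      have h1 : x ∈ C → x ∈ M.E := fun hx ↦ hCE hx
      have h2 : x ∈ D → x ∈ M.E := fun hx ↦ hDE hx
      simp only [mem_sdiff, mem_union]
      tauto
    · have := hform Y hY
      lia
    · have := hform Y hY
      lia
  exfalso
  -- Here the `M₁` term is vacuous above `C`, so the minor is a minor of the lift of `M₂`, and `M₂`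
  -- would yield `M₁`.
  by_cases hcase₁ : M₁.rk M₁.E ≤ M₁.rk C + (C ∩ U₁).ncard
  · obtain ⟨N₂, hyN, hN₂, hE₂, hr₂⟩ :=
      M₂.exists_yields_lift h.finite_A₂ h.finite_U₂ h.disj_A₂ h.disj_U₂ h.disj_AU₂
    have hNM : N₂.E = M.E := by rw [hE₂, hM.ground_eq, h.ground_eq]
    have hrM : ∀ Y ⊆ (M ／ C ＼ D).E, M.rk (Y ∪ C) = N₂.rk (Y ∪ C) := by
      intro Y hY
      have := le_liftRk (A₂ := A₁) hk₁ (M.ground_finite.subset (hYE Y hY)) subset_union_right hcase₁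
      rw [hM.rk_eq _ (hYE Y hY), hr₂ _ (hNM ▸ hYE Y hY)]
      lia
    have hCi : N₂.Indep C := by
      rw [indep_iff_rk hCf] at hC ⊢
      have := hrM ∅ (empty_subset _)
      rw [empty_union] at this
      rw [← this, hC]
    have heq : M ／ C ＼ D = N₂ ／ C ＼ D := by
      have hE : (M ／ C ＼ D).E = (N₂ ／ C ＼ D).E := by
        rw [hNE, delete_ground, contract_ground, hNM]
      refine ext_rk hE fun Y hY ↦ ?_
      have h1 := hrk Y hY
      have h2 := rk_contract_delete hCi (hE ▸ hY)
      rw [hrM Y hY] at h1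
      lia
    exact hy ((hyN.minor (contract_delete_isMinor N₂ C D)).iso (heq ▸ hiso))
  -- If neither term is saturated, then `|C ∩ Uᵢ| < |Sᵢ \ C|`, so `|C| < |S₁| + |S₂|`, too small for
  -- `|C| = k - r(M₁)`.
  · have h1 : C ⊆ (M₁.E ∩ C ∪ M₂.E ∩ C) ∪ (C ∩ U₁ ∪ C ∩ U₂) := by
      intro x hx
      have := h.ground_subset (hM.ground_eq ▸ hCE hx)
      simp only [mem_union, mem_inter_iff] at this ⊢
      tauto
    have h2 := ncard_le_ncard h1 (((hCf.subset inter_subset_right).union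
      (hCf.subset inter_subset_right)).union ((hCf.subset inter_subset_left).union
      (hCf.subset inter_subset_left)))
    have h3 := ncard_union_le (M₁.E ∩ C ∪ M₂.E ∩ C) (C ∩ U₁ ∪ C ∩ U₂)
    have h4 := ncard_union_le (M₁.E ∩ C) (M₂.E ∩ C)
    have h5 := ncard_union_le (C ∩ U₁) (C ∩ U₂)
    have h6 := M₁.rk_le_rk_add_ncard_sdiff M₁.ground_finite C
    have h7 := M₂.rk_le_rk_add_ncard_sdiff M₂.ground_finite C
    have h8 := ncard_inter_add_ncard_sdiff_eq_ncard M₁.E C M₁.ground_finite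
    have h9 := ncard_inter_add_ncard_sdiff_eq_ncard M₂.E C M₂.ground_finite
    have h10 := M₁.rk_le_ncard M₁.ground_finite
    have h11 := h.large₁
    have h12 := h.large₂
    lia

end IsLiftMeet

lemma mem_FI_of_forall {x : α} (hx : x ∈ M.E) (h : ∀ F, M.IsNonemptyProperCyclicFlat F → x ∉ F) :
    x ∈ M.FI := by
  refine ⟨hx, fun F hF hne hxF ↦ h F ⟨hF, ⟨x, hxF⟩, hne⟩ hxF⟩

/-- A proper cyclic flat of the dual containing `x` would have as complement a nonempty proper
cyclic flat of `M` avoiding `x`. -/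
lemma mem_FI_dual_of_forall [M.Finite] {x : α} (hx : x ∈ M.E)
    (h : ∀ F, M.IsNonemptyProperCyclicFlat F → x ∈ F) : x ∈ M✶.FI := by
  refine ⟨hx, fun G hG hne hxG ↦ ?_⟩
  have hGE : G ⊆ M.E := hG.subset_ground
  have h1 := hG.compl_dual
  rw [dual_dual, dual_ground] at h1
  refine (h _ ⟨h1, ?_, ?_⟩).2 hxG
  · exact nonempty_of_ssubset (hGE.ssubset_of_ne hne)
  · exact fun heq ↦ (heq.ge hx).2 hxG

lemma IsLiftMeet.isIntertwine (h : IsLiftPair M₁ A₁ U₁ M₂ A₂ U₂ k)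
    (hM : M.IsLiftMeet M₁ A₁ U₁ M₂ A₂ U₂ k) (hy₁ : ¬ M₂.Yields M₁) (hy₂ : ¬ M₁.Yields M₂)
    (hZ₁ : ∃ F, M₁.IsNonemptyProperCyclicFlat F) (hZ₂ : ∃ F, M₂.IsNonemptyProperCyclicFlat F)
    (hFI₁ : M₁.FI ⊆ A₂) (hFI₁' : Disjoint A₂ M₁✶.FI) (hFI₂ : M₂.FI ⊆ A₁)
    (hFI₂' : Disjoint A₁ M₂✶.FI) : M.IsIntertwine M₁ M₂ := by
  have hfin := hM.finite h
  have := h.finite₁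
  have := h.finite₂
  refine ⟨⟨⟨_, contract_delete_isMinor M A₁ U₁, ?_⟩, ⟨_, contract_delete_isMinor M A₂ U₂, ?_⟩⟩, ?_⟩
  · rw [hM.contract_delete_eq h]; exact .refl _
  · rw [(hM.symm h).contract_delete_eq h.symm]; exact .refl _
  rintro N hNM ⟨⟨N₁, hN₁, hiso₁⟩, ⟨N₂, hN₂, hiso₂⟩⟩
  obtain ⟨C, D, hC, hD, hCD, rfl⟩ := hNM.isMinor.exists_eq_contract_delete_indep_coindep
  -- A further minor contracts and deletes supersets of `C` and `D`, so the constraints on those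
  -- supersets pass down to `C` and `D`.
  have aux : ∀ N', N' ≤m M ／ C ＼ D → ∃ C' D', C ⊆ C' ∧ D ⊆ D' ∧ M.Indep C' ∧ M.Coindep D' ∧
      Disjoint C' D' ∧ N' = M ／ C' ＼ D' := by
    intro N' hN'
    obtain ⟨C₀, D₀, hC₀, hD₀, hCD₀, rfl⟩ := hN'.exists_eq_contract_delete_indep_coindep
    have hC₀E := hC₀.subset_ground
    have hD₀E : D₀ ⊆ (M ／ C ＼ D).E := hD₀.subset_ground
    have hC₀D : Disjoint C₀ D := disjoint_sdiff_left.mono_left hC₀E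
    have hD₀C : Disjoint D₀ C := disjoint_sdiff_left.mono_left (hD₀E.trans sdiff_subset)
    refine ⟨C ∪ C₀, D ∪ D₀, subset_union_left, subset_union_left, ?_, ?_, ?_, ?_⟩
    · rw [union_comm]
      exact (hC.contract_indep_iff.1 hC₀.of_delete).2
    · have h1 : (M✶ ／ D ＼ C).Indep D₀ := by
        rw [contract_delete_comm _ hCD.symm, ← dual_contract_delete]
        exact hD₀
      rw [union_comm]
      exact (hD.contract_indep_iff.1 h1.of_delete).2
    · rw [disjoint_union_left, disjoint_union_right, disjoint_union_right]
      exact ⟨⟨hCD, hD₀C.symm⟩, hC₀D, hCD₀⟩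
    · exact contract_delete_contract_delete _ _ _ _ _ hC₀D
  obtain ⟨C₁, D₁, hCC₁, hDD₁, hC₁, hD₁, hCD₁, rfl⟩ := aux N₁ hN₁
  obtain ⟨C₂, D₂, hCC₂, hDD₂, hC₂, hD₂, hCD₂, rfl⟩ := aux N₂ hN₂
  have hF₁ : ∀ F, M₁.IsNonemptyProperCyclicFlat F → C ⊆ F ∪ A₁ ∧ Disjoint D (F ∪ A₁) := fun F hF ↦
    (hM.subset_and_disjoint_of_minor h hy₁ hC₁ hD₁ hCD₁ hiso₁ hF).imp hCC₁.trans
      fun h ↦ h.mono_left hDD₁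
  have hF₂ : ∀ F, M₂.IsNonemptyProperCyclicFlat F → C ⊆ F ∪ A₂ ∧ Disjoint D (F ∪ A₂) := fun F hF ↦
    ((hM.symm h).subset_and_disjoint_of_minor h.symm hy₂ hC₂ hD₂ hCD₂ hiso₂ hF).imp hCC₂.trans
      fun h ↦ h.mono_left hDD₂
  obtain ⟨Z₁, hZ₁⟩ := hZ₁
  obtain ⟨Z₂, hZ₂⟩ := hZ₂
  -- An element of `C` in `A₁` misses `A₂`, hence lies in all nonempty proper cyclic flats of `M₂`
  -- and in `FI(M₂✶)`, which `A₁` avoids. Outside `A₁` it lies in all those of `M₁`, hence in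
  -- `FI(M₁✶)` and not in `A₂`; then it would also be in `M₂.E`.
  have hC0 : C = ∅ := by
    refine eq_empty_of_forall_notMem fun x hx ↦ ?_
    by_cases hxA : x ∈ A₁
    · have hxF : ∀ F, M₂.IsNonemptyProperCyclicFlat F → x ∈ F := fun F hF ↦
        ((hF₂ F hF).1 hx).resolve_right (disjoint_left.1 h.disj_A hxA)
      exact disjoint_left.1 hFI₂' hxA
        (mem_FI_dual_of_forall (hZ₂.1.subset_ground (hxF _ hZ₂)) hxF)
    · have hxF : ∀ F, M₁.IsNonemptyProperCyclicFlat F → x ∈ F := fun F hF ↦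
        ((hF₁ F hF).1 hx).resolve_right hxA
      have hxE := hZ₁.1.subset_ground (hxF _ hZ₁)
      have hxA₂ : x ∉ A₂ := fun h ↦ disjoint_left.1 hFI₁' h (mem_FI_dual_of_forall hxE hxF)
      have := ((hF₂ _ hZ₂).1 hx).resolve_right hxA₂
      exact disjoint_left.1 h.disj_ground hxE (hZ₂.1.subset_ground this)
  -- An element of `D` avoids all flats and both `Aᵢ`; in `Mᵢ.E` it would be in `FI(Mᵢ)`, which the
  -- opposite `A` contains. Only the empty set `U₁ ∩ U₂` remains.
  have hD0 : D = ∅ := by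
    refine eq_empty_of_forall_notMem fun x hx ↦ ?_
    have hxE : x ∈ M.E := hD.subset_ground hx
    have hx₁ : ∀ F, M₁.IsNonemptyProperCyclicFlat F → x ∉ F ∪ A₁ := fun F hF ↦
      disjoint_left.1 (hF₁ F hF).2 hx
    have hx₂ : ∀ F, M₂.IsNonemptyProperCyclicFlat F → x ∉ F ∪ A₂ := fun F hF ↦
      disjoint_left.1 (hF₂ F hF).2 hx
    have hxA₁ : x ∉ A₁ := fun h ↦ hx₁ _ hZ₁ (.inr h)
    have hxA₂ : x ∉ A₂ := fun h ↦ hx₂ _ hZ₂ (.inr h)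
    have hxM₁ : x ∉ M₁.E := fun h ↦ hxA₂ (hFI₁ (mem_FI_of_forall h fun F hF hxF ↦
      hx₁ F hF (.inl hxF)))
    have hxM₂ : x ∉ M₂.E := fun h ↦ hxA₁ (hFI₂ (mem_FI_of_forall h fun F hF hxF ↦
      hx₂ F hF (.inl hxF)))
    have hxE₁ := hM.ground_eq ▸ hxE
    have hxE₂ := h.ground_eq ▸ hxE₁
    simp only [mem_union, hxM₁, hxA₁, hxM₂, hxA₂, false_or] at hxE₁ hxE₂
    exact disjoint_left.1 h.disj_U hxE₁ hxE₂
  refine hNM.ne ?_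
  rw [hC0, hD0, contract_empty, delete_empty]

end LiftPair

/-! ### From the hypotheses of the theorem to a pair of lifts -/

section Construction

variable {α : Type u} {M M₁ M₂ : Matroid α} {S₁' S₂' T₁ T₂ : Set α} {k : ℕ}

lemma nonempty_ground_of_not_yields (h : ¬ M₂.Yields M₁) : M₁.E.Nonempty := by
  rw [nonempty_iff_ne_empty]
  intro hE
  refine h (.minor .refl (N' := M₁) ?_)
  have : M₁ = M₂ ／ ∅ ＼ M₂.E := by
    rw [ground_eq_empty_iff.1 hE, eq_comm, ← ground_eq_empty_iff]
    simp
  rw [this]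
  exact contract_delete_isMinor _ _ _

/-- With no such flat, every element is vacuously in both `FI(M)` and `FI(M✶)`. The converse,
`disjoint_FI_dual_FI`, makes the disjointness easy to carry along isomorphisms. -/
lemma exists_isNonemptyProperCyclicFlat [M.Finite] (hE : M.E.Nonempty)
    (hd : Disjoint M.FI M✶.FI) : ∃ F, M.IsNonemptyProperCyclicFlat F := by
  by_contra! hcon
  obtain ⟨x, hx⟩ := hE
  exact disjoint_left.1 hd (mem_FI_of_forall hx fun F hF ↦ (hcon F hF).elim)
    (mem_FI_dual_of_forall hx fun F hF ↦ (hcon F hF).elim)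

lemma IsNonemptyProperCyclicFlat.disjoint_FI_dual_FI [M.Finite] {F : Set α}
    (hF : M.IsNonemptyProperCyclicFlat F) : Disjoint M.FI M✶.FI := by
  rw [disjoint_left]
  intro x hx hx'
  refine hx'.2 (M.E \ F) hF.1.compl_dual (fun h ↦ ?_) ⟨hx.1, hx.2 F hF.1 hF.2.2⟩
  obtain ⟨e, he⟩ := hF.2.1
  exact (h.ge (hF.1.subset_ground he)).2 he

lemma isLiftPair_of_encard [M₁.Finite] [M₂.Finite] (hdisj : Disjoint M₁.E M₂.E)
    (hne₁ : M₁.E.Nonempty) (hne₂ : M₂.E.Nonempty) (hS₁ : S₁' ⊆ M₁.E) (hS₂ : S₂' ⊆ M₂.E)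
    (hk : 4 * max M₁.E.encard M₂.E.encard ≤ (k : ℕ∞))
    (hT₁ : T₁.encard + M₁.eRank + S₂'.encard = (k : ℕ∞))
    (hT₂ : T₂.encard + M₂.eRank + S₁'.encard = (k : ℕ∞)) (hTT : Disjoint T₁ T₂)
    (hTE₁ : Disjoint T₁ (M₁.E ∪ M₂.E)) (hTE₂ : Disjoint T₂ (M₁.E ∪ M₂.E)) :
    IsLiftPair M₁ (T₁ ∪ S₂') (T₂ ∪ (M₂.E \ S₂')) M₂ (T₂ ∪ S₁') (T₁ ∪ (M₁.E \ S₁')) k := by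
  rw [disjoint_union_right] at hTE₁ hTE₂
  have hTf : ∀ (T S : Set α) (r : ℕ∞), T.encard + r + S.encard = (k : ℕ∞) → T.Finite := by
    intro T S r h
    rw [← encard_lt_top_iff]
    calc T.encard ≤ T.encard + r + S.encard := by rw [add_assoc]; exact le_self_add
      _ < ⊤ := by rw [h]; exact WithTop.coe_lt_top k
  have hT₁f := hTf _ _ _ hT₁
  have hT₂f := hTf _ _ _ hT₂
  have hS₁f := M₁.ground_finite.subset hS₁
  have hS₂f := M₂.ground_finite.subset hS₂
  have hlarge : ∀ S : Set α, S.Finite → S.encard ≤ max M₁.E.encard M₂.E.encard →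
      4 * S.ncard ≤ k := by
    intro S hS hle
    have h1 : 4 * S.encard ≤ (k : ℕ∞) := (by gcongr : _ ≤ 4 * max M₁.E.encard M₂.E.encard).trans hk
    rw [← hS.cast_ncard_eq] at h1
    exact_mod_cast h1
  have hrank : ∀ (M : Matroid α) [M.Finite] (T S : Set α), T.Finite → S.Finite → Disjoint T S →
      T.encard + M.eRank + S.encard = (k : ℕ∞) → M.rk M.E + (T ∪ S).ncard = k := by
    intro M _ T S hT hS hTS h
    rw [← eRk_ground, ← coe_rk, ← hT.cast_ncard_eq, ← hS.cast_ncard_eq] at h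
    have h : T.ncard + M.rk M.E + S.ncard = k := by exact_mod_cast h
    rw [ncard_union_eq hTS hT hS]
    lia
  exact
  { finite₁ := inferInstance
    finite₂ := inferInstance
    finite_A₁ := hT₁f.union hS₂f
    finite_U₁ := hT₂f.union (M₂.ground_finite.subset sdiff_subset)
    finite_A₂ := hT₂f.union hS₁f
    finite_U₂ := hT₁f.union (M₁.ground_finite.subset sdiff_subset)
    nonempty₁ := hne₁
    nonempty₂ := hne₂
    disj_A₁ := disjoint_union_left.2 ⟨hTE₁.1, hdisj.symm.mono_left hS₂⟩
    disj_U₁ := disjoint_union_left.2 ⟨hTE₂.1, hdisj.symm.mono_left sdiff_subset⟩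
    disj_AU₁ := disjoint_union_left.2 ⟨disjoint_union_right.2 ⟨hTT, hTE₁.2.mono_right sdiff_subset⟩,
      disjoint_union_right.2 ⟨hTE₂.2.symm.mono_left hS₂, disjoint_sdiff_right⟩⟩
    disj_A₂ := disjoint_union_left.2 ⟨hTE₂.2, hdisj.mono_left hS₁⟩
    disj_U₂ := disjoint_union_left.2 ⟨hTE₁.2, hdisj.mono_left sdiff_subset⟩
    disj_AU₂ := disjoint_union_left.2 ⟨disjoint_union_right.2 ⟨hTT.symm,
      hTE₂.1.mono_right sdiff_subset⟩,
      disjoint_union_right.2 ⟨hTE₁.1.symm.mono_left hS₁, disjoint_sdiff_right⟩⟩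
    disj_ground := hdisj
    disj_A := disjoint_union_left.2 ⟨disjoint_union_right.2 ⟨hTT, hTE₁.1.mono_right hS₁⟩,
      disjoint_union_right.2 ⟨hTE₂.2.symm.mono_left hS₂, hdisj.symm.mono hS₂ hS₁⟩⟩
    disj_U := disjoint_union_left.2 ⟨disjoint_union_right.2 ⟨hTT.symm,
      hTE₂.1.mono_right sdiff_subset⟩, disjoint_union_right.2
      ⟨hTE₁.2.symm.mono_left sdiff_subset, hdisj.symm.mono sdiff_subset sdiff_subset⟩⟩
    ground_eq := by
      ext x
      have h1 : x ∈ S₁' → x ∈ M₁.E := fun h ↦ hS₁ h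
      have h2 : x ∈ S₂' → x ∈ M₂.E := fun h ↦ hS₂ h
      simp only [mem_union, mem_sdiff]
      tauto
    rank₁ := hrank M₁ T₁ S₂' hT₁f hS₂f (hTE₁.2.mono_right hS₂) hT₁
    rank₂ := hrank M₂ T₂ S₁' hT₂f hS₁f (hTE₂.1.mono_right hS₁) hT₂
    large₁ := hlarge M₁.E M₁.ground_finite (le_max_left _ _)
    large₂ := hlarge M₂.E M₂.ground_finite (le_max_right _ _) }

lemma IsLiftMeet.isIntertwineConstruction (hS₁ : S₁' ⊆ M₁.E) (hS₂ : S₂' ⊆ M₂.E)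
    (hTE₁ : Disjoint T₁ (M₁.E ∪ M₂.E)) (hTE₂ : Disjoint T₂ (M₁.E ∪ M₂.E))
    (h : IsLiftPair M₁ (T₁ ∪ S₂') (T₂ ∪ (M₂.E \ S₂')) M₂ (T₂ ∪ S₁') (T₁ ∪ (M₁.E \ S₁')) k)
    (hM : M.IsLiftMeet M₁ (T₁ ∪ S₂') (T₂ ∪ (M₂.E \ S₂')) M₂ (T₂ ∪ S₁') (T₁ ∪ (M₁.E \ S₁')) k) :
    M.IsIntertwineConstruction k M₁ S₁' T₁ M₂ S₂' T₂ := by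
  have hfin := hM.finite h
  have := h.finite₁
  have := h.finite₂
  have hE : M.E = M₁.E ∪ M₂.E ∪ T₁ ∪ T₂ := by
    rw [hM.ground_eq]
    ext x
    have h2 : x ∈ S₂' → x ∈ M₂.E := fun h ↦ hS₂ h
    simp only [mem_union, mem_sdiff]
    tauto
  rw [disjoint_union_right] at hTE₁ hTE₂
  refine ⟨hE, fun Z ↦ ?_, fun F hF ↦ ?_, fun F hF ↦ ?_, M.eRk_empty, ?_⟩
  · rw [hM.isCyclicFlat_iff h, ← hE]
    simp only [union_assoc]
  · rw [union_assoc, ← coe_rk, (hM.union_isCyclicFlat h hF).2, add_assoc,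
      ← encard_union_eq (hTE₁.2.mono_right hS₂), Nat.cast_add, coe_rk, h.finite_A₁.cast_ncard_eq]
  · rw [union_assoc, ← coe_rk, ((hM.symm h).union_isCyclicFlat h.symm hF).2, add_assoc,
      ← encard_union_eq (hTE₂.1.mono_right hS₁), Nat.cast_add, coe_rk, h.finite_A₂.cast_ncard_eq]
  · rw [← eRk_ground, ← coe_rk, hM.rk_ground h]

lemma IsIntertwineConstruction.eq [M.Finite] {M' : Matroid α}
    (h : M.IsIntertwineConstruction k M₁ S₁' T₁ M₂ S₂' T₂)
    (h' : M'.IsIntertwineConstruction k M₁ S₁' T₁ M₂ S₂' T₂) : M' = M := by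
  refine (ext_isCyclicFlat (h.ground_eq.trans h'.ground_eq.symm)
    (fun F ↦ (h.isCyclicFlat_iff F).trans (h'.isCyclicFlat_iff F).symm) fun Z hZ ↦ ?_).symm
  obtain rfl | rfl | ⟨F, hF, rfl⟩ | ⟨F, hF, rfl⟩ := (h.isCyclicFlat_iff Z).1 hZ
  · rw [rk_empty, rk_empty]
  · nth_rw 1 [← h.ground_eq]
    rw [← h'.ground_eq, rk, rk, eRk_ground, eRk_ground, h.eRank_eq, h'.eRank_eq]
  · rw [rk, rk, h.eRk_left F hF, h'.eRk_left F hF]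
  · rw [rk, rk, h.eRk_right F hF, h'.eRk_right F hF]

theorem exists_unique_isIntertwineConstruction [M₁.Finite] [M₂.Finite]
    (hdisj : Disjoint M₁.E M₂.E) (h₁ : ¬ M₂.Yields M₁) (h₂ : ¬ M₁.Yields M₂)
    (hFI₁ : M₁.FI ⊆ S₁') (hS₁ : S₁' ⊆ M₁.E \ M₁✶.FI)
    (hFI₂ : M₂.FI ⊆ S₂') (hS₂ : S₂' ⊆ M₂.E \ M₂✶.FI)
    (hk : 4 * max M₁.E.encard M₂.E.encard ≤ (k : ℕ∞))
    (hT₁ : T₁.encard + M₁.eRank + S₂'.encard = (k : ℕ∞))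
    (hT₂ : T₂.encard + M₂.eRank + S₁'.encard = (k : ℕ∞)) (hTT : Disjoint T₁ T₂)
    (hTE₁ : Disjoint T₁ (M₁.E ∪ M₂.E)) (hTE₂ : Disjoint T₂ (M₁.E ∪ M₂.E)) :
    ∃ M : Matroid α, M.IsIntertwineConstruction k M₁ S₁' T₁ M₂ S₂' T₂ ∧
      (∀ M' : Matroid α, M'.IsIntertwineConstruction k M₁ S₁' T₁ M₂ S₂' T₂ → M' = M) ∧
      M.IsIntertwine M₁ M₂ ∧ M.Finite := by
  have hS₁E := hS₁.trans sdiff_subset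
  have hS₂E := hS₂.trans sdiff_subset
  have hne₁ := nonempty_ground_of_not_yields h₁
  have hne₂ := nonempty_ground_of_not_yields h₂
  have hFd₁ : Disjoint S₁' M₁✶.FI := disjoint_sdiff_left.mono_left hS₁
  have hFd₂ : Disjoint S₂' M₂✶.FI := disjoint_sdiff_left.mono_left hS₂
  have h := isLiftPair_of_encard hdisj hne₁ hne₂ hS₁E hS₂E hk hT₁ hT₂ hTT hTE₁ hTE₂
  obtain ⟨M, hM⟩ := h.exists_isLiftMeet
  have hMf := hM.finite h
  have hMc := hM.isIntertwineConstruction hS₁E hS₂E hTE₁ hTE₂ h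
  refine ⟨M, hMc, fun M' hM' ↦ hMc.eq hM', ?_, hMf⟩
  have hFIE₁ : M₁✶.FI ⊆ M₁.E := fun x hx ↦ hx.1
  have hFIE₂ : M₂✶.FI ⊆ M₂.E := fun x hx ↦ hx.1
  exact hM.isIntertwine h h₁ h₂
    (exists_isNonemptyProperCyclicFlat hne₁ (hFd₁.mono_left hFI₁))
    (exists_isNonemptyProperCyclicFlat hne₂ (hFd₂.mono_left hFI₂))
    (hFI₁.trans subset_union_right)
    (disjoint_union_left.2 ⟨(hTE₂.mono_right subset_union_left).mono_right hFIE₁, hFd₁⟩)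
    (hFI₂.trans subset_union_right)
    (disjoint_union_left.2 ⟨(hTE₁.mono_right subset_union_right).mono_right hFIE₂, hFd₂⟩)

end Construction

/-! ### Invariance under isomorphism and change of type -/

section Transfer

variable {α : Type u} {β : Type v} {M N : Matroid α}

lemma Yields.trans {α β γ : Type u} {M : Matroid α} {N : Matroid β} {K : Matroid γ}
    (h : M.Yields N) (h' : N.Yields K) : M.Yields K := by
  induction h' with
  | refl => exact h
  | iso _ h₂ ih => exact ih.iso h₂
  | minor _ h₂ ih => exact ih.minor h₂
  | freeExtension x _ h₂ ih => exact ih.freeExtension x h₂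
  | freeCoextension x _ h₂ ih => exact ih.freeCoextension x h₂

lemma Yields.of_isIsomorphic {α β γ δ : Type u} {M : Matroid α} {N : Matroid β} {M' : Matroid γ}
    {N' : Matroid δ} (h : M'.Yields N') (hM : M.IsIsomorphic M') (hN : N.IsIsomorphic N') :
    M.Yields N :=
  ((Yields.refl.iso hM).trans h).iso hN.symm

lemma HasMinorIso.of_isIsomorphic {γ δ : Type*} {M : Matroid α} {K : Matroid γ} {K' : Matroid δ}
    (h : M.HasMinorIso K) (hK : K.IsIsomorphic K') : M.HasMinorIso K' := by
  obtain ⟨N, hN, hi⟩ := h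
  exact ⟨N, hN, hi.trans hK⟩

lemma IsIntertwine.of_isIsomorphic {γ δ : Type*} {M : Matroid α} {K₁ K₂ : Matroid γ}
    {K₁' K₂' : Matroid δ} (h : M.IsIntertwine K₁ K₂) (h₁ : K₁.IsIsomorphic K₁')
    (h₂ : K₂.IsIsomorphic K₂') : M.IsIntertwine K₁' K₂' :=
  ⟨⟨h.1.1.of_isIsomorphic h₁, h.1.2.of_isIsomorphic h₂⟩, fun N hN hN' ↦
    h.2 N hN ⟨hN'.1.of_isIsomorphic h₁.symm, hN'.2.of_isIsomorphic h₂.symm⟩⟩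

lemma mapEquiv_delete (M : Matroid α) (f : α ≃ β) (D : Set α) :
    (M ＼ D).mapEquiv f = M.mapEquiv f ＼ (f '' D) := by
  refine ext_indep (by simp [image_sdiff f.injective]) fun I _ ↦ ?_
  rw [mapEquiv_indep_iff, delete_indep_iff, delete_indep_iff, mapEquiv_indep_iff,
    ← disjoint_image_iff f.injective, f.image_symm_image]

lemma mapEquiv_dual (M : Matroid α) (f : α ≃ β) : (M.mapEquiv f)✶ = M✶.mapEquiv f := by
  rw [mapEquiv_eq_map, map_dual, mapEquiv_eq_map]

lemma mapEquiv_contract (M : Matroid α) (f : α ≃ β) (C : Set α) :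
    (M ／ C).mapEquiv f = M.mapEquiv f ／ (f '' C) := by
  rw [← dual_inj, mapEquiv_dual, dual_contract, mapEquiv_delete, dual_contract, mapEquiv_dual]

lemma IsMinor.mapEquiv (h : N ≤m M) (f : α ≃ β) : N.mapEquiv f ≤m M.mapEquiv f := by
  obtain ⟨C, D, rfl⟩ := h
  exact ⟨f '' C, f '' D, by rw [mapEquiv_delete, mapEquiv_contract]⟩

lemma mapEquiv_mapEquiv_symm (M : Matroid α) (f : α ≃ β) : (M.mapEquiv f).mapEquiv f.symm = M := by
  refine ext_indep (by simp) fun I _ ↦ ?_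
  simp

lemma IsStrictMinor.mapEquiv (h : N <m M) (f : α ≃ β) : N.mapEquiv f <m M.mapEquiv f := by
  refine ⟨h.isMinor.mapEquiv f, fun h' ↦ h.not_isMinor ?_⟩
  simpa only [mapEquiv_mapEquiv_symm] using h'.mapEquiv f.symm

lemma isIsomorphic_mapEquiv (M : Matroid α) (f : α ≃ β) : M.IsIsomorphic (M.mapEquiv f) :=
  isIsomorphic_map M f f.injective.injOn

lemma HasMinorIso.mapEquiv {γ : Type*} {K : Matroid γ} (h : M.HasMinorIso K) (f : α ≃ β) :
    (M.mapEquiv f).HasMinorIso K := by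
  obtain ⟨N, hN, hi⟩ := h
  exact ⟨N.mapEquiv f, hN.mapEquiv f, (isIsomorphic_mapEquiv N f).symm.trans hi⟩

lemma IsIntertwine.mapEquiv {γ : Type*} {K₁ K₂ : Matroid γ} (h : M.IsIntertwine K₁ K₂)
    (f : α ≃ β) : (M.mapEquiv f).IsIntertwine K₁ K₂ := by
  refine ⟨⟨h.1.1.mapEquiv f, h.1.2.mapEquiv f⟩, fun N hN hN' ↦
    h.2 (N.mapEquiv f.symm) ?_ ⟨hN'.1.mapEquiv f.symm, hN'.2.mapEquiv f.symm⟩⟩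
  rw [← mapEquiv_mapEquiv_symm M f]
  exact hN.mapEquiv f.symm

end Transfer

/-! ### Infinitely many intertwines -/

/-- In an infinite type, the construction can be carried out for every large enough rank. -/
theorem exists_isIntertwine_of_rank {α : Type u} [Infinite α] {M₁ M₂ : Matroid α} [M₁.Finite]
    [M₂.Finite] (hdisj : Disjoint M₁.E M₂.E) (h₁ : ¬ M₂.Yields M₁) (h₂ : ¬ M₁.Yields M₂)
    (hFI₁ : Disjoint M₁.FI M₁✶.FI) (hFI₂ : Disjoint M₂.FI M₂✶.FI) {k : ℕ}
    (hk : 4 * max M₁.E.encard M₂.E.encard ≤ (k : ℕ∞)) :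
    ∃ M : Matroid α, M.Finite ∧ M.IsIntertwine M₁ M₂ ∧ M.rk M.E = k := by
  have hf := M₁.ground_finite.union M₂.ground_finite
  have hFIE : ∀ M : Matroid α, M.FI ⊆ M.E := fun M x hx ↦ hx.1
  have hle : ∀ (M N : Matroid α) [M.Finite] [N.Finite], M.E.encard ≤ max M₁.E.encard M₂.E.encard →
      N.E.encard ≤ max M₁.E.encard M₂.E.encard → M.rk M.E + N.FI.ncard ≤ k := by
    intro M N _ _ hM hN
    have h1 : M.E.encard + N.E.encard ≤ (k : ℕ∞) := by
      refine (add_le_add hM hN).trans (le_trans ?_ hk)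
      rw [← two_mul]
      gcongr
      norm_num
    rw [← M.ground_finite.cast_ncard_eq, ← N.ground_finite.cast_ncard_eq] at h1
    have h1 : M.E.ncard + N.E.ncard ≤ k := by exact_mod_cast h1
    have h2 := M.rk_le_ncard M.ground_finite
    have h3 := ncard_le_ncard (hFIE N) N.ground_finite
    lia
  have hle₁ := hle M₁ M₂ (le_max_left _ _) (le_max_right _ _)
  have hle₂ := hle M₂ M₁ (le_max_right _ _) (le_max_left _ _)
  have hcast : ∀ (M N : Matroid α) [M.Finite] [N.Finite] (T : Set α), T.Finite →
      M.rk M.E + N.FI.ncard ≤ k → T.ncard = k - (M.rk M.E + N.FI.ncard) →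
      T.encard + M.eRank + N.FI.encard = (k : ℕ∞) := by
    intro M N _ _ T hT hle hcard
    have : T.ncard + M.rk M.E + N.FI.ncard = k := by lia
    rw [← eRk_ground, ← coe_rk, ← hT.cast_ncard_eq,
      ← (N.ground_finite.subset (hFIE N)).cast_ncard_eq]
    exact_mod_cast this
  obtain ⟨T₁, hT₁s, hT₁f, hT₁⟩ :=
    hf.infinite_compl.exists_subset_ncard_eq (k - (M₁.rk M₁.E + M₂.FI.ncard))
  obtain ⟨T₂, hT₂s, hT₂f, hT₂⟩ :=
    (hf.union hT₁f).infinite_compl.exists_subset_ncard_eq (k - (M₂.rk M₂.E + M₁.FI.ncard))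
  rw [subset_compl_iff_disjoint_right] at hT₁s hT₂s
  rw [disjoint_union_right] at hT₂s
  -- The smallest admissible choice is taken: `Sᵢ' = FI(Mᵢ)`.
  obtain ⟨M, hM, -, hMi, hMf⟩ := exists_unique_isIntertwineConstruction hdisj h₁ h₂ Subset.rfl
    (subset_sdiff.2 ⟨hFIE M₁, hFI₁⟩) Subset.rfl (subset_sdiff.2 ⟨hFIE M₂, hFI₂⟩) hk
    (hcast M₁ M₂ T₁ hT₁f hle₁ hT₁) (hcast M₂ M₁ T₂ hT₂f hle₂ hT₂) hT₂s.2.symm hT₁s hT₂s.1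
  refine ⟨M, hMf, hMi, ?_⟩
  rw [rk, eRk_ground, hM.eRank_eq, ENat.toNat_natCast]

end Matroid

open Matroid in
theorem theorem3 {α : Type u} (M₁ M₂ : Matroid α) [M₁.Finite] [M₂.Finite]
    (hdisj : Disjoint M₁.E M₂.E)
    (h₁ : ¬ M₂.Yields M₁) (h₂ : ¬ M₁.Yields M₂)
    (S₁' S₂' : Set α)
    (hFI₁ : M₁.FI ⊆ S₁') (hS₁ : S₁' ⊆ M₁.E \ M₁✶.FI)
    (hFI₂ : M₂.FI ⊆ S₂') (hS₂ : S₂' ⊆ M₂.E \ M₂✶.FI) :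
    (∀ (k : ℕ) (T₁ T₂ : Set α),
      4 * max M₁.E.encard M₂.E.encard ≤ (k : ℕ∞) →
      T₁.encard + M₁.eRank + S₂'.encard = (k : ℕ∞) →
      T₂.encard + M₂.eRank + S₁'.encard = (k : ℕ∞) →
      Disjoint T₁ T₂ → Disjoint T₁ (M₁.E ∪ M₂.E) → Disjoint T₂ (M₁.E ∪ M₂.E) →
      ∃ M : Matroid α,
        M.IsIntertwineConstruction k M₁ S₁' T₁ M₂ S₂' T₂ ∧
        (∀ M' : Matroid α, M'.IsIntertwineConstruction k M₁ S₁' T₁ M₂ S₂' T₂ → M' = M) ∧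
        M.IsIntertwine M₁ M₂) ∧
    (∃ N : ℕ → Matroid ℕ,
      (∀ n, (N n).Finite ∧ (N n).IsIntertwine M₁ M₂) ∧
      ∀ m n, m ≠ n → ¬ (N m).IsIsomorphic (N n)) := by
  refine ⟨fun k T₁ T₂ hk hT₁ hT₂ hTT hTE₁ hTE₂ ↦ ?_, ?_⟩
  · obtain ⟨M, hM, hu, hi, -⟩ := exists_unique_isIntertwineConstruction hdisj h₁ h₂ hFI₁ hS₁ hFI₂
      hS₂ hk hT₁ hT₂ hTT hTE₁ hTE₂
    exact ⟨M, hM, hu, hi⟩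
  obtain ⟨f, hf⟩ := countable_iff_exists_injOn.1
    (M₁.ground_finite.union M₂.ground_finite).countable
  -- The type `α` may be too small to contain `T₁` and `T₂` for large `k`. The copy stays in
  -- universe `u`, where `Yields` can compare it with the original; only the resulting intertwines
  -- are moved to `ℕ`.
  let g : α → ULift.{u} ℕ := fun x ↦ ULift.up (f x)
  have hg : InjOn g (M₁.E ∪ M₂.E) := fun x hx y hy hxy ↦ hf hx hy (congrArg ULift.down hxy)
  have hg₁ : InjOn g M₁.E := hg.mono subset_union_left
  have hg₂ : InjOn g M₂.E := hg.mono subset_union_right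
  have hi₁ := isIsomorphic_map M₁ g hg₁
  have hi₂ := isIsomorphic_map M₂ g hg₂
  have hfin₁ := hi₁.finite
  have hfin₂ := hi₂.finite
  have hdisj' : Disjoint (M₁.map g hg₁).E (M₂.map g hg₂).E := by
    rw [map_ground, map_ground]
    exact hdisj.image hg subset_union_left subset_union_right
  have hFI : ∀ (M : Matroid α) [M.Finite] (S : Set α) (hg : InjOn g M.E), M.E.Nonempty →
      M.FI ⊆ S → S ⊆ M.E \ M✶.FI → Disjoint (M.map g hg).FI (M.map g hg)✶.FI := by
    intro M _ S hg hne hS hS'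
    have hi := isIsomorphic_map M g hg
    have := hi.finite
    obtain ⟨F, hF⟩ := exists_isNonemptyProperCyclicFlat hne
      (disjoint_sdiff_left.mono_left (hS.trans hS'))
    obtain ⟨ψ, -, hψ⟩ := hi.exists_map_cyclicFlat
    exact (hψ F hF).1.disjoint_FI_dual_FI
  obtain ⟨k₀, hk₀⟩ : ∃ k₀, k₀ = 4 * max (M₁.map g hg₁).E.ncard (M₂.map g hg₂).E.ncard := ⟨_, rfl⟩
  have hk : ∀ n : ℕ, 4 * max (M₁.map g hg₁).E.encard (M₂.map g hg₂).E.encard ≤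
      ((k₀ + n : ℕ) : ℕ∞) := by
    intro n
    rw [← hfin₁.ground_finite.cast_ncard_eq, ← hfin₂.ground_finite.cast_ncard_eq,
      ← (Nat.mono_cast (α := ℕ∞)).map_max]
    have : 4 * max (M₁.map g hg₁).E.ncard (M₂.map g hg₂).E.ncard ≤ k₀ + n := by lia
    exact_mod_cast this
  choose N hNf hNi hNr using fun n ↦ exists_isIntertwine_of_rank hdisj'
    (fun h ↦ h₁ (h.of_isIsomorphic hi₂ hi₁)) (fun h ↦ h₂ (h.of_isIsomorphic hi₁ hi₂))
    (hFI M₁ S₁' hg₁ (nonempty_ground_of_not_yields h₁) hFI₁ hS₁)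
    (hFI M₂ S₂' hg₂ (nonempty_ground_of_not_yields h₂) hFI₂ hS₂) (hk n)
  have hiso : ∀ n, (N n).IsIsomorphic ((N n).mapEquiv Equiv.ulift) :=
    fun n ↦ isIsomorphic_mapEquiv _ _
  refine ⟨fun n ↦ (N n).mapEquiv Equiv.ulift, fun n ↦ ⟨(hiso n).finite,
    ((hNi n).mapEquiv Equiv.ulift).of_isIsomorphic hi₁.symm hi₂.symm⟩, fun m n hmn hi ↦ hmn ?_⟩
  -- The `n`-th intertwine has rank `k₀ + n`, and rank is an isomorphism invariant.
  have h := (((hiso m).trans hi).trans (hiso n).symm).rk_ground_eq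
  rw [hNr, hNr] at h
  lia
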